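/- Let $\langle m,n,p\rangle=q$ ($m,n,p\ge 1$) be a base-case bilinear algorithm: it multiplies an $m\times n$ matrix $A$ by an $n\times p$ matrix $B$ using $q$ scalar multiplications, the $r$-th of which multiplies a linear form in the entries of $A$ by a linear form in the entries of $B$; the entries of $AB$ are linear combinations of the $q$ products. (Approximate algorithms in the sense of Bini et al., whose coefficients are Laurent polynomials in a parameter $\lambda$ and which compute $AB$ up to terms of positive order in $\lambda$, are allowed; exact algorithms are those with constant coefficients.) Its encoding graph for $A$ (respectively $B$) is the bipartite graph with the $N=mn$ (respectively $N=np$) matrix entries as inputs and the $q$ linear forms as outputs, in which an input is joined to every output in which it occurs. An output is copied from an input if that input is its only neighbour, and the graph has no multiply-copied inputs if no input is copied to two outputs. For $t\ge 1$ let $H_t$ be the computational graph (CDAG) of the algorithm $\langle m^t,n^t,p^t\rangle=q^t$ obtained by $t$ levels of recursion of the base case: its vertices are the inputs and the binary arithmetic operations (each linear combination of the base case is computed by some fixed full binary tree, and a copied output is the same vertex as the input it is copied from). Let $W=W(t,M)$ be the communication cost of $H_t$, that is, the minimum number of words transferred between a fast memory of $M$ words and an unlimited slow memory over all executions that perform every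 operation of $H_t$ exactly once, in an order consistent with $H_t$, with all operands in fast memory, starting with empty fast memory and the inputs in slow memory and ending with the outputs in slow memory ($W=\infty$ if there is no such execution). Suppose that the encoding graph for $A$ or for $B$, with $N=mn$ or $N=np$ inputs respectively, has no multiply-copied inputs and consists of exactly $X$ connected components, all having the same number $N/X$ of inputs and all having the same number $q/X$ of outputs, where $X<N$ (so that the logarithms below have base greater than $1$). Then $$W=\Omega\left(\frac{q^t}{t^{\log_{N/X}(q/X)}\,M^{\log_{N/X}(q/X)-1}}\right),$$ that is, there is a constant $c>0$, depending only on the base case, such that for all integers $t\ge 1$ and $M\ge 1$, $$W(t,M)\ \ge\ c\cdot\frac{q^t}{t^{\log_{N/X}(q/X)}\,M^{\log_{N/X}(q/X)-1}}.$$ -/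

import Mathlib

open scoped ENNReal LaurentPolynomial

noncomputable section

namespace RectMM

/-! ### Base-case bilinear algorithms -/

/-- The coefficients of a bilinear algorithm that multiplies an `m × n` matrix by an `n × p` matrix
with `q` scalar multiplications. The `r`-th scalar multiplication multiplies the linear form
`encA r` of the entries of the first factor by the linear form `encB r` of the entries of the second
factor; each entry of the product is a linear combination, given by `decC`, of the `q` products.
Coefficients are Laurent polynomials in a parameter `λ` (written `T` in Mathlib), so that
approximate algorithms in the sense of Bini et al. are included; algorithms over `R` are those with
constant coefficients. -/
structure BilinearAlgorithm (R : Type*) [CommRing R] (m n p q : ℕ) where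
  encA : Fin q → Fin m × Fin n → R[T;T⁻¹]
  encB : Fin q → Fin n × Fin p → R[T;T⁻¹]
  decC : Fin m × Fin p → Fin q → R[T;T⁻¹]

/-- What the algorithm returns at position `o` when it is run on the matrices `A` and `B`. -/
def BilinearAlgorithm.eval {R : Type*} [CommRing R] {m n p q : ℕ}
    (alg : BilinearAlgorithm R m n p q)
    (A : Matrix (Fin m) (Fin n) R) (B : Matrix (Fin n) (Fin p) R) (o : Fin m × Fin p) :
    R[T;T⁻¹] :=
  ∑ r : Fin q, alg.decC o r *
    ((∑ x : Fin m × Fin n, alg.encA r x * LaurentPolynomial.C (A x.1 x.2)) *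
     (∑ x : Fin n × Fin p, alg.encB r x * LaurentPolynomial.C (B x.1 x.2)))

/-- The algorithm multiplies matrices up to terms of positive order in `λ`. If all coefficients are
constants, the error term is forced to vanish and the algorithm is exact. -/
def BilinearAlgorithm.Correct {R : Type*} [CommRing R] {m n p q : ℕ}
    (alg : BilinearAlgorithm R m n p q) : Prop :=
  ∀ (A : Matrix (Fin m) (Fin n) R) (B : Matrix (Fin n) (Fin p) R) (o : Fin m × Fin p),
    ∃ f : Polynomial R, alg.eval A B o =
      LaurentPolynomial.C ((A * B) o.1 o.2) + LaurentPolynomial.T 1 * Polynomial.toLaurent f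

/-! ### The base-case encoding graph -/

/-- The inputs that occur in the `j`-th linear form. -/
def formSupport {S I J : Type*} [Zero S] (coef : J → I → S) (j : J) : Set I := {i | coef j i ≠ 0}

/-- The (undirected) graph of a family of linear forms: input `i` is joined to output `j` if `i`
occurs in the `j`-th form. -/
def formGraph {S I J : Type*} [Zero S] (coef : J → I → S) : SimpleGraph (I ⊕ J) :=
  SimpleGraph.fromRel fun u v => ∃ i j, u = Sum.inl i ∧ v = Sum.inr j ∧ i ∈ formSupport coef j

/-- An output is copied from the input `i` if its only incoming edge comes from `i`. No input is
copied to two outputs. -/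
def NoMultiplyCopied {S I J : Type*} [Zero S] (coef : J → I → S) : Prop :=
  ∀ (i : I) (j j' : J), formSupport coef j = {i} → formSupport coef j' = {i} → j = j'

/-- The graph of the forms has exactly `X` connected components; all of them have the same number of
inputs, and all of them have the same number of outputs. -/
def HasEqualComponents {S I J : Type*} [Zero S] (coef : J → I → S) (X : ℕ) : Prop :=
  Nat.card (formGraph coef).ConnectedComponent = X ∧
  ∀ c c' : (formGraph coef).ConnectedComponent,
    {i : I | Sum.inl i ∈ c.supp}.ncard = {i : I | Sum.inl i ∈ c'.supp}.ncard ∧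
    {j : J | Sum.inr j ∈ c.supp}.ncard = {j : J | Sum.inr j ∈ c'.supp}.ncard

/-! ### Binary trees that compute linear combinations -/

/-- Ways to compute a linear combination by binary operations. The coefficients play no role for the
graph and are omitted. -/
inductive SumTree (α : Type) : Type
  | zero : SumTree α
  | leaf (a : α) : SumTree α
  | add (l r : SumTree α) : SumTree α

namespace SumTree

/-- The operands at the leaves. -/
def leaves {α : Type} : SumTree α → List α
  | zero => []
  | leaf a => [a]
  | add l r => l.leaves ++ r.leaves

/-- The constant `zero` does not occur. -/
def ZeroFree {α : Type} : SumTree α → Prop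
  | zero => False
  | leaf _ => True
  | add l r => l.ZeroFree ∧ r.ZeroFree

/-- The tree is a full binary tree whose leaves are the elements of `s`, each exactly once
(or the constant zero, if `s` is empty). -/
def Draws {α : Type} (T : SumTree α) (s : Set α) : Prop :=
  (T = zero ∨ T.ZeroFree) ∧ T.leaves.Nodup ∧ ∀ a, a ∈ T.leaves ↔ a ∈ s

/-- The vertices of the tree other than its leaves: one for each binary operation. -/
def Node {α : Type} : SumTree α → Type
  | zero => Unit
  | leaf _ => Empty
  | add l r => Option (l.Node ⊕ r.Node)

/-- The root of the tree: a leaf if the tree is a single leaf, an inner vertex otherwise. -/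
def top {α : Type} : (T : SumTree α) → α ⊕ T.Node
  | zero => Sum.inr ()
  | leaf a => Sum.inl a
  | add _ _ => Sum.inr none

/-- The two operands of an inner vertex, each of which is a leaf or another inner vertex. -/
def operands {α : Type} : (T : SumTree α) → T.Node → List (α ⊕ T.Node)
  | zero, _ => []
  | leaf _, ν => nomatch (show Empty from ν)
  | add l r, none => [l.top.map id fun ν => some (Sum.inl ν), r.top.map id fun ν => some (Sum.inr ν)]
  | add l _, some (Sum.inl ν) => (l.operands ν).map (Sum.map id fun ν' => some (Sum.inl ν'))
  | add _ r, some (Sum.inr ν) => (r.operands ν).map (Sum.map id fun ν' => some (Sum.inr ν'))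

end SumTree

/-! ### Recursive encoding and decoding graphs -/

/-- Vertices of the graphs obtained by applying a base-case family of forms (from `I`-indexed inputs
to `J`-indexed outputs, drawn by the trees `T`) recursively. The values at level `k` of the depth-`t`
recursion are indexed by a word `y` of length `k` over `J` (last letter first), the indices already
processed, and a word `z` of length `t - k` over `I`, the indices still to be processed.
`input z` is the input with index `z`, and `add y j ν z` is the operation `ν` of the tree that
computes the value `(j :: y, z)` from the values `(y, i :: z)`. -/
inductive LinVertex {I J : Type} (T : J → SumTree I) : Type
  | input (z : List I) : LinVertex T
  | add (y : List J) (j : J) (ν : (T j).Node) (z : List I) : LinVertex T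

namespace LinVertex

variable {I J : Type} {T : J → SumTree I}

/-- The depth of the recursion to which a vertex belongs. -/
def depth : LinVertex T → ℕ
  | input z => z.length
  | add y _ _ z => y.length + 1 + z.length

/-- The vertex that holds the value with index `(y, z)`. A value that is copied from the previous
level is held by the same vertex as the value it is copied from. -/
def value (T : J → SumTree I) : List J → List I → LinVertex T
  | [], z => input z
  | j :: y, z =>
    match (T j).top with
    | Sum.inl i => value T y (i :: z)
    | Sum.inr ν => add y j ν z

/-- There is an edge from `u` to `v` if `u` is an operand of the operation `v`. -/
def Edge (u : LinVertex T) : LinVertex T → Prop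
  | input _ => False
  | add y j ν z => ∃ x ∈ (T j).operands ν,
      u = match x with
        | Sum.inl i => value T y (i :: z)
        | Sum.inr ν' => add y j ν' z

end LinVertex

/-! ### Computational graphs and their communication cost -/

/-- A computational graph: input values, operations, and the values to be returned; an edge leads
from each operand of an operation to the operation. -/
structure CDAG (V : Type) where
  inputs : Set V
  ops : Set V
  outputs : Set V
  edge : V → V → Prop

/-- The values that are present in fast and in slow memory. -/
structure Memory (V : Type) where
  fast : Finset V
  slow : Set V

/-- The instructions of the two-level machine. -/
inductive Move (V : Type) : Type
  | read (v : V) : Move V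
  | write (v : V) : Move V
  | evict (v : V) : Move V
  | compute (v : V) : Move V

namespace Move

/-- The operation that is performed, if any. -/
def computed? {V : Type} : Move V → Option V
  | compute v => some v
  | _ => none

/-- Whether a word is transferred between fast and slow memory. -/
def isTransfer {V : Type} : Move V → Bool
  | read _ => true
  | write _ => true
  | _ => false

end Move

namespace CDAG

variable {V : Type}

open Classical in
/-- One step of the machine with `M` words of fast memory and unlimited slow memory. An operation
needs all its operands in fast memory; its result may overwrite values in fast memory. -/
inductive Step (G : CDAG V) (M : ℕ) : Memory V → Move V → Memory V → Prop
  | read (F : Finset V) (L : Set V) (v : V) (hv : v ∈ L) (hM : (insert v F).card ≤ M) :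
      Step G M ⟨F, L⟩ (Move.read v) ⟨insert v F, L⟩
  | write (F : Finset V) (L : Set V) (v : V) (hv : v ∈ F) :
      Step G M ⟨F, L⟩ (Move.write v) ⟨F, insert v L⟩
  | evict (F : Finset V) (L : Set V) (v : V) :
      Step G M ⟨F, L⟩ (Move.evict v) ⟨F.erase v, L⟩
  | compute (F F' : Finset V) (L : Set V) (v : V) (hv : v ∈ G.ops)
      (hops : ∀ u, G.edge u v → u ∈ F) (hF : F' ⊆ F) (hM : (insert v F').card ≤ M) :
      Step G M ⟨F, L⟩ (Move.compute v) ⟨insert v F', L⟩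

/-- A sequence of steps of the machine. -/
inductive Run (G : CDAG V) (M : ℕ) : Memory V → List (Move V) → Memory V → Prop
  | nil (s : Memory V) : Run G M s [] s
  | cons {s s' s'' : Memory V} {a : Move V} {σ : List (Move V)}
      (h : Step G M s a s') (hs : Run G M s' σ s'') : Run G M s (a :: σ) s''

/-- An execution of the computation: initially fast memory is empty and the inputs are in slow
memory, every operation of the graph is performed exactly once, and at the end the outputs are in
slow memory. -/
def IsSchedule (G : CDAG V) (M : ℕ) (σ : List (Move V)) : Prop :=
  (σ.filterMap Move.computed?).Nodup ∧
  (∀ v, v ∈ σ.filterMap Move.computed? ↔ v ∈ G.ops) ∧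
  ∃ s : Memory V, G.Run M ⟨∅, G.inputs⟩ σ s ∧ G.outputs ⊆ s.slow

/-- The communication cost `W` of the computation with fast memory of size `M`: the least number of
words transferred between fast and slow memory, over all executions (infinite if there is none). -/
def commCost (G : CDAG V) (M : ℕ) : ℝ≥0∞ :=
  ⨅ (σ : List (Move V)) (_ : G.IsSchedule M σ), (σ.countP Move.isTransfer : ℝ≥0∞)

end CDAG

/-! ### The computational graph of the recursive algorithm -/

/-- A way to compute each of the linear combinations of a base case by a binary tree. -/
structure Drawing {R : Type*} [CommRing R] {m n p q : ℕ} (alg : BilinearAlgorithm R m n p q) where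
  treeA : Fin q → SumTree (Fin m × Fin n)
  treeB : Fin q → SumTree (Fin n × Fin p)
  treeC : Fin m × Fin p → SumTree (Fin q)
  drawsA : ∀ r, (treeA r).Draws (formSupport alg.encA r)
  drawsB : ∀ r, (treeB r).Draws (formSupport alg.encB r)
  drawsC : ∀ o, (treeC o).Draws (formSupport alg.decC o)

namespace Drawing

variable {R : Type*} [CommRing R] {m n p q : ℕ} {alg : BilinearAlgorithm R m n p q}

/-- Vertices of the encoding graph of the first factor, of the encoding graph of the second factor,
and of the decoding graph of the product. The inputs of the decoding graph are the scalar
multiplications. -/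
inductive Vertex (D : Drawing alg) : Type
  | encA (v : LinVertex D.treeA) : Vertex D
  | encB (v : LinVertex D.treeB) : Vertex D
  | dec (v : LinVertex D.treeC) : Vertex D

/-- The edges inside the three parts, and the edges that join the outputs of the two encoding graphs
with index `y` to the scalar multiplication with index `y`. -/
inductive Edge (D : Drawing alg) : D.Vertex → D.Vertex → Prop
  | encA {u v : LinVertex D.treeA} (h : u.Edge v) : Edge D (.encA u) (.encA v)
  | encB {u v : LinVertex D.treeB} (h : u.Edge v) : Edge D (.encB u) (.encB v)
  | dec {u v : LinVertex D.treeC} (h : u.Edge v) : Edge D (.dec u) (.dec v)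
  | mulA (y : List (Fin q)) : Edge D (.encA (LinVertex.value D.treeA y [])) (.dec (.input y))
  | mulB (y : List (Fin q)) : Edge D (.encB (LinVertex.value D.treeB y [])) (.dec (.input y))

/-- The input entries of the depth-`t` recursion. -/
inductive IsInput (D : Drawing alg) (t : ℕ) : D.Vertex → Prop
  | encA (z : List (Fin m × Fin n)) (hz : z.length = t) : IsInput D t (.encA (.input z))
  | encB (z : List (Fin n × Fin p)) (hz : z.length = t) : IsInput D t (.encB (.input z))

/-- The arithmetic operations of the depth-`t` recursion. -/
inductive IsOp (D : Drawing alg) (t : ℕ) : D.Vertex → Prop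
  | encA (y : List (Fin q)) (r : Fin q) (ν : (D.treeA r).Node) (z : List (Fin m × Fin n))
      (h : (LinVertex.add y r ν z : LinVertex D.treeA).depth = t) : IsOp D t (.encA (.add y r ν z))
  | encB (y : List (Fin q)) (r : Fin q) (ν : (D.treeB r).Node) (z : List (Fin n × Fin p))
      (h : (LinVertex.add y r ν z : LinVertex D.treeB).depth = t) : IsOp D t (.encB (.add y r ν z))
  | dec (v : LinVertex D.treeC) (h : v.depth = t) : IsOp D t (.dec v)

/-- The computational graph of the algorithm that multiplies an `m ^ t × n ^ t` matrix by an
`n ^ t × p ^ t` matrix by `t` levels of recursion of the base case. -/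
def cdag (D : Drawing alg) (t : ℕ) : CDAG D.Vertex where
  inputs := {v | D.IsInput t v}
  ops := {v | D.IsOp t v}
  outputs := {v | ∃ w : List (Fin m × Fin p), w.length = t ∧ v = .dec (LinVertex.value D.treeC w [])}
  edge := D.Edge

end Drawing

end RectMM

end

/-! Let a = N/X and b = q/X be the numbers of inputs and outputs of a component and ω = log_a b. An
execution is cut into segments with ⌊b^k/2⌋ scalar multiplications each. If exactly one of the
operand u and the operation v of an edge is performed in a segment, then u is in fast memory at its
beginning or end or is transferred during it, so there are at most 2M + w such boundary vertices,
where w is the number of transfers in the segment (`CDAG.IsSchedule.exists_boundary`). It remains to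
see that this boundary is large.

That is the isoperimetric inequality for the last k levels of the encoding graph
(`Route.isoperimetric`), proved by double counting. A route fixes the earlier letters and, at each
of the k levels, a component together with one input and one output of it. Consecutive values of a
route lie in one component of a copy of the base graph. So if the status (performed in the segment
or not) differs at the two ends, connectedness yields a boundary vertex in one of these components
or at the last value (`Route.exists_meets`). Each word is the end of at least a^k routes. For a
fixed start at most half of the b^k ends lie in the segment, so at least as many routes change
status as end in the segment. On the other hand, a vertex is met at a given level by at most a·b^k
routes (`Route.ncard_meets_le`), because without multiply-copied inputs it determines most of the
route. Hence s multiplications have a boundary of at least s·a^k / ((k+1)·a·b^k).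

For the least k with a^k ≥ 24atM, every segment needs M transfers, and b^k = (a^k)^ω is of order
(tM)^ω. If this k exceeds t, the same count on the whole graph, with "is an operation" as status,
bounds the number of inputs to be read (`EncodingEmbedding.pow_mul_pow_le`); `real_bound` joins the
two cases. Correctness of the algorithm enters only through N ≤ q, that is a ≤ b, which is a rank
argument. -/

noncomputable section

namespace RectMM

/-! ### Propagation along a tree -/

namespace SumTree

theorem top_eq_of_mem_leaves {α : Type} {T : SumTree α} {i : α} (hi : i ∈ T.leaves) :
    T.top = Sum.inl i ∨ ∃ ν, T.top = Sum.inr ν := by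
  cases T with
  | zero => simp [leaves] at hi
  | leaf a =>
    left
    have : i = a := by simpa [leaves] using hi
    rw [this]; rfl
  | add l r => exact Or.inr ⟨none, rfl⟩

/-- A property that is the same for every operation and its operands, the leaves other than `i`
excepted, is the same for the leaf `i` and the root. -/
theorem status_leaf_iff_top {α : Type} {i : α} : ∀ (T : SumTree α) (st : α ⊕ T.Node → Prop)
    (_ : ∀ ν, ∀ x ∈ T.operands ν, (x = Sum.inl i ∨ ∃ ν', x = Sum.inr ν') →
      (st x ↔ st (Sum.inr ν))) (_ : i ∈ T.leaves),
    (st (Sum.inl i) ↔ st T.top)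
  | zero, _, _, hi => by simp [leaves] at hi
  | leaf a, st, _, hi => by
      have : i = a := by simpa [leaves] using hi
      subst this
      exact Iff.rfl
  | add l r, st, h, hi => by
      -- One argument for both subtrees: `f` includes the operations of `T'`, and the root of `T'`
      -- is an operand of the new operation.
      have key : ∀ (T' : SumTree α) (f : T'.Node → (add l r).Node), i ∈ T'.leaves →
          (∀ st' : α ⊕ T'.Node → Prop, (∀ ν, ∀ x ∈ T'.operands ν,
            (x = Sum.inl i ∨ ∃ ν', x = Sum.inr ν') → (st' x ↔ st' (Sum.inr ν))) →
            (st' (Sum.inl i) ↔ st' T'.top)) →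
          (∀ ν, ∀ x ∈ T'.operands ν, Sum.map id f x ∈ (add l r).operands (f ν)) →
          T'.top.map id f ∈ (add l r).operands none →
          (st (Sum.inl i) ↔ st (add l r).top) := by
        intro T' f hi' ih hf htop
        have h1 := ih (fun x => st (Sum.map id f x)) (fun ν x hx hx' => by
          refine h (f ν) _ (hf ν x hx) ?_
          rcases hx' with rfl | ⟨ν', rfl⟩
          · exact Or.inl rfl
          · exact Or.inr ⟨_, rfl⟩)
        refine h1.trans (h none _ htop ?_)
        rcases top_eq_of_mem_leaves hi' with h' | ⟨ν, h'⟩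
        · rw [h']; exact Or.inl rfl
        · rw [h']; exact Or.inr ⟨_, rfl⟩
      rcases List.mem_append.1 (show i ∈ l.leaves ++ r.leaves from hi) with hi' | hi'
      · exact key l (fun ν => some (Sum.inl ν)) hi'
          (fun st' h' => status_leaf_iff_top l st' h' hi')
          (fun ν x hx => List.mem_map.2 ⟨x, hx, rfl⟩) (List.mem_cons_self ..)
      · exact key r (fun ν => some (Sum.inr ν)) hi'
          (fun st' h' => status_leaf_iff_top r st' h' hi')
          (fun ν x hx => List.mem_map.2 ⟨x, hx, rfl⟩)
          (List.mem_cons_of_mem _ (List.mem_cons_self ..))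

end SumTree

/-! ### Vertices that hold values -/

namespace LinVertex

variable {I J : Type} {T : J → SumTree I}

/-- A copied value stays at the vertex where it was first computed, which can be older than the
level of the value but never newer. This separates the inputs of a recursion step from its
operations. -/
theorem length_lt_of_value_eq_add : ∀ {y : List J} {z : List I} {y' : List J} {j : J}
    {ν : (T j).Node} {z' : List I}, value T y z = add y' j ν z' → y'.length < y.length
  | [], z, y', j, ν, z', h => by simp [value] at h
  | j₀ :: y, z, y', j, ν, z', h => by
      rw [value] at h
      split at h
      · have := length_lt_of_value_eq_add h
        simp only [List.length_cons]; omega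
      · injection h with h1
        simp [h1]

end LinVertex

/-! ### Connected components of the base-case graph -/

section Forms

variable {S I J : Type*} [Zero S] {coef : J → I → S}

theorem formGraph_adj_iff {i : I} {j : J} :
    (formGraph coef).Adj (Sum.inl i) (Sum.inr j) ↔ i ∈ formSupport coef j := by
  simp [formGraph]

/-- Numberings of the inputs and of the outputs in which the first coordinate is the connected
component. -/
structure BalancedComponents (coef : J → I → S) (C : Type*) (a b : ℕ) where
  inp : I ≃ C × Fin a
  out : J ≃ C × Fin b
  fst_eq : ∀ {i j}, i ∈ formSupport coef j → (inp i).1 = (out j).1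
  reachable : ∀ {i j}, (inp i).1 = (out j).1 →
    (formGraph coef).Reachable (Sum.inl i) (Sum.inr j)

/-- Induction along a walk. The component `κ` is constant on it, so the hypothesis is needed only
for edges of this component. -/
theorem BalancedComponents.status_iff {C : Type*} {a b : ℕ} (E : BalancedComponents coef C a b)
    (st : I ⊕ J → Prop) (i : I) (j : J) (hij : (E.inp i).1 = (E.out j).1)
    (h : ∀ i' j', i' ∈ formSupport coef j' → (E.inp i').1 = (E.inp i).1 →
      (st (Sum.inl i') ↔ st (Sum.inr j'))) :
    st (Sum.inl i) ↔ st (Sum.inr j) := by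
  let κ : I ⊕ J → C := Sum.elim (fun i => (E.inp i).1) (fun j => (E.out j).1)
  suffices H : ∀ x y, (formGraph coef).Reachable x y → κ x = (E.inp i).1 → (st x ↔ st y) from
    H _ _ (E.reachable hij) rfl
  rintro x y ⟨w⟩
  induction w with
  | nil => exact fun _ => Iff.rfl
  | @cons u v w huv _ ih =>
    intro hu
    have : κ u = κ v ∧ (st u ↔ st v) := by
      rcases u with i1 | j1 <;> rcases v with i2 | j2
      · simp [formGraph] at huv
      · have h' := formGraph_adj_iff.1 huv
        exact ⟨E.fst_eq h', h _ _ h' hu⟩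
      · have h' := formGraph_adj_iff.1 huv.symm
        exact ⟨(E.fst_eq h').symm, (h _ _ h' ((E.fst_eq h').trans hu)).symm⟩
      · simp [formGraph] at huv
    exact this.2.trans (ih (this.1 ▸ hu))

end Forms

/-! ### One step of the recursion -/

section Encoding

variable {S : Type*} {I J : Type} [Zero S] {coef : J → I → S} {T : J → SumTree I}

open LinVertex

/-- Two values share a vertex only by copying; this translates copying in the tree into the
condition on supports in `NoMultiplyCopied`. -/
theorem SumTree.Draws.eq_singleton {α : Type} {T : SumTree α} {s : Set α} (h : T.Draws s) {i : α}
    (hT : T.top = Sum.inl i) : s = {i} := by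
  cases T with
  | zero => simp [SumTree.top] at hT
  | leaf a =>
    have : a = i := by simpa [SumTree.top] using hT
    subst this
    ext x
    rw [← h.2.2 x]
    simp [SumTree.leaves]
  | add _ _ => simp [SumTree.top] at hT

/-- At a given level, different values are held by different vertices. -/
theorem LinVertex.value_injective (hT : ∀ j, (T j).Draws (formSupport coef j))
    (hcoef : NoMultiplyCopied coef) : ∀ {y y' : List J} {z z' : List I}, y.length = y'.length →
      value T y z = value T y' z' → y = y' ∧ z = z'
  | [], [], z, z', _, h => by simpa [value] using h
  | j :: y, j' :: y', z, z', hl, h => by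
      have hl' : y.length = y'.length := by simpa using hl
      rw [value, value] at h
      split at h <;> split at h
      -- Both values are copied, by induction from the same input `i`; as `i` is not copied twice,
      -- the last letters agree. In the two mixed cases an operation of this level would hold a
      -- value of the previous one.
      · rename_i i hi _ i' hi'
        obtain ⟨h1, h2⟩ := value_injective hT hcoef hl' h
        obtain ⟨rfl, rfl⟩ := List.cons_eq_cons.1 h2
        exact ⟨by rw [h1, hcoef i j j' ((hT j).eq_singleton hi) ((hT j').eq_singleton hi')], rfl⟩
      · have := length_lt_of_value_eq_add h; omega
      · have := length_lt_of_value_eq_add h.symm; omega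
      · injection h with h1 h2 h3 h4
        exact ⟨by rw [h1, h2], h4⟩

variable {C : Type*} {a b : ℕ}

/-- If a property is different for two values of the same component of a recursion step, then an
operand with a bad edge occurs in that component. -/
theorem BalancedComponents.exists_bad (E : BalancedComponents coef C a b)
    (hT : ∀ j, (T j).Draws (formSupport coef j)) (P bad : LinVertex T → Prop) (y : List J)
    (z : List I) (h : ∀ u v : LinVertex T, u.Edge v → v.depth = y.length + 1 + z.length →
      (P u ↔ P v) ∨ bad u)
    (i : I) (j : J) (hij : (E.inp i).1 = (E.out j).1)
    (hP : ¬ (P (value T y (i :: z)) ↔ P (value T (j :: y) z))) :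
    (∃ i', (E.inp i').1 = (E.inp i).1 ∧ bad (value T y (i' :: z))) ∨
      ∃ j' ν, (E.out j').1 = (E.inp i).1 ∧ bad (add y j' ν z) := by
  -- Without a bad operand, the status passes through every tree from each leaf to the root, hence
  -- along every edge of the component.
  by_contra! hbad
  refine hP (E.status_iff
    (Sum.elim (fun i => P (value T y (i :: z))) (fun j => P (value T (j :: y) z))) i j hij ?_)
  intro i' j' hij' hi'
  have hj' : (E.out j').1 = (E.inp i).1 := (E.fst_eq hij').symm.trans hi'
  have := SumTree.status_leaf_iff_top (T j') (i := i')
    (fun x => P (match x with | Sum.inl i => value T y (i :: z) | Sum.inr ν => add y j' ν z))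
    (by
      intro ν x hx hx'
      rcases h _ (add y j' ν z) ⟨x, hx, rfl⟩ rfl with h1 | h1
      · exact h1
      · exfalso
        rcases hx' with rfl | ⟨ν', rfl⟩
        · exact hbad.1 i' hi' h1
        · exact hbad.2 j' ν' hj' h1)
    (((hT j').2.2 i').2 hij')
  simp only [Sum.elim_inl, Sum.elim_inr]
  rw [value]
  refine this.trans (Iff.of_eq ?_)
  cases (T j').top <;> rfl

end Encoding

/-! ### Routes and the isoperimetric inequality -/

section Counting

open LinVertex

variable {S : Type*} {I J : Type} [Zero S] {coef : J → I → S} {T : J → SumTree I}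
variable {C : Type} {a b d k : ℕ}

/-- A block of `k` levels of recursion below the prefix `pre`, a component at each of its levels,
and the positions of an input and of an output in the component. -/
structure Route (J C : Type) (a b d k : ℕ) where
  pre : Fin d → J
  comp : Fin k → C
  inPos : Fin k → Fin a
  outPos : Fin k → Fin b

/-- The data of a route as a tuple. -/
def Route.equivProd (J C : Type) (a b d k : ℕ) :
    Route J C a b d k ≃
      (((Fin d → J) × (Fin k → C)) × (Fin k → Fin a)) × (Fin k → Fin b) where
  toFun ω := (((ω.pre, ω.comp), ω.inPos), ω.outPos)
  invFun x := ⟨x.1.1.1, x.1.1.2, x.1.2, x.2⟩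
  left_inv _ := rfl
  right_inv _ := rfl

namespace Route

variable (E : BalancedComponents coef C a b) (ω : Route J C a b d k)

/-- The letters over `J` among the letters of the value at level `l` of the route. -/
def done (l : ℕ) : List J :=
  ((List.ofFn fun m => E.out.symm (ω.comp m, ω.outPos m)).take l).reverse ++ List.ofFn ω.pre

/-- The letters over `I` among the letters of the value at level `l` of the route. -/
def todo (l : ℕ) : List I :=
  (List.ofFn fun m => E.inp.symm (ω.comp m, ω.inPos m)).drop l

theorem done_succ (l : Fin k) :
    ω.done E (l + 1) = E.out.symm (ω.comp l, ω.outPos l) :: ω.done E l := by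
  have hl : (l : ℕ) < (List.ofFn fun m => E.out.symm (ω.comp m, ω.outPos m)).length := by simp
  simp [done, List.take_succ_eq_append_getElem hl]

theorem todo_eq_cons (l : Fin k) :
    ω.todo E l = E.inp.symm (ω.comp l, ω.inPos l) :: ω.todo E (l + 1) := by
  have hl : (l : ℕ) < (List.ofFn fun m => E.inp.symm (ω.comp m, ω.inPos m)).length := by simp
  simp [todo, List.drop_eq_getElem_cons hl]

theorem length_done {l : ℕ} (hl : l ≤ k) :
    (ω.done E l).length = l + d := by
  simp [done, hl]

theorem length_todo (l : ℕ) : (ω.todo E l).length = k - l := by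
  simp [todo]

theorem todo_self : ω.todo E k = [] := by
  simp [todo]

variable {E ω} {ω' : Route J C a b d k}

theorem eq_of_done_eq {l : ℕ} (h : ω.done E l = ω'.done E l) :
    ω.pre = ω'.pre ∧ ∀ m : Fin k, (m : ℕ) < l →
      ω.comp m = ω'.comp m ∧ ω.outPos m = ω'.outPos m := by
  obtain ⟨h1, h2⟩ := List.append_inj h (by simp)
  refine ⟨List.ofFn_injective h2, fun m hm => ?_⟩
  have h3 := congrArg (fun L => L[(m : ℕ)]?) (List.reverse_injective h1)
  have h4 : E.out.symm (ω.comp m, ω.outPos m) = E.out.symm (ω'.comp m, ω'.outPos m) := by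
    simpa [List.getElem?_take, hm] using h3
  simpa using E.out.symm.injective h4

theorem eq_of_todo_eq {l : ℕ} (h : ω.todo E l = ω'.todo E l) (m : Fin k) (hm : l ≤ m) :
    ω.comp m = ω'.comp m ∧ ω.inPos m = ω'.inPos m := by
  have h3 := congrArg (fun L => L[(m : ℕ) - l]?) h
  have h4 : E.inp.symm (ω.comp m, ω.inPos m) = E.inp.symm (ω'.comp m, ω'.inPos m) := by
    simpa [todo, List.getElem?_drop, Nat.add_sub_cancel' hm] using h3
  simpa using E.inp.symm.injective h4

variable (E ω) in
/-- The vertex `v` occurs in the part of the graph that the route passes between the levels `l` and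
`l + 1`, or after the last level. -/
def Meets (T : J → SumTree I) (v : LinVertex T) : Option (Fin k) → Prop
  | none => value T (ω.done E k) [] = v
  | some l =>
    (∃ i, (E.inp i).1 = ω.comp l ∧ value T (ω.done E l) (i :: ω.todo E (l + 1)) = v) ∨
    ∃ j ν, (E.out j).1 = ω.comp l ∧ add (ω.done E l) j ν (ω.todo E (l + 1)) = v

/-- The vertex is either an input of this recursion step, and `value_injective` applies, or one of
its operations, whose label shows the words. Lengths exclude a mixture. Only the two positions at
level `l` itself stay undetermined. -/
theorem Meets.eq (hT : ∀ j, (T j).Draws (formSupport coef j)) (hcoef : NoMultiplyCopied coef)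
    {v : LinVertex T} {l : Fin k} (h : ω.Meets E T v (some l)) (h' : ω'.Meets E T v (some l)) :
    ω.done E l = ω'.done E l ∧ ω.todo E (l + 1) = ω'.todo E (l + 1) ∧ ω.comp l = ω'.comp l := by
  have hlen : (ω.done E l).length = (ω'.done E l).length := by
    rw [length_done _ _ l.2.le, length_done _ _ l.2.le]
  rcases h with ⟨i, hi, hv⟩ | ⟨j, ν, hj, hv⟩ <;> rcases h' with ⟨i', hi', hv'⟩ | ⟨j', ν', hj', hv'⟩
  · obtain ⟨h1, h2⟩ := value_injective hT hcoef hlen (hv.trans hv'.symm)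
    obtain ⟨rfl, h3⟩ := List.cons_eq_cons.1 h2
    exact ⟨h1, h3, hi.symm.trans hi'⟩
  · have := length_lt_of_value_eq_add (hv.trans hv'.symm); omega
  · have := length_lt_of_value_eq_add (hv'.trans hv.symm); omega
  · have h3 := hv.trans hv'.symm
    injection h3 with h1 h2 h3 h4
    subst h2
    exact ⟨h1, h4, hj.symm.trans hj'⟩

/-- Few routes meet a given vertex at a given level. -/
theorem ncard_meets_le (hT : ∀ j, (T j).Draws (formSupport coef j))
    (hcoef : NoMultiplyCopied coef) (ha : 0 < a) (hab : a ≤ b) (v : LinVertex T)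
    (o : Option (Fin k)) :
    {ω : Route J C a b d k | ω.Meets E T v o}.ncard ≤ a * b ^ k := by
  have hcard : (Set.univ : Set (Fin a × (Fin k → Fin b))).ncard = a * b ^ k := by
    simp [Set.ncard_univ, Nat.card_eq_fintype_card]
  rw [← hcard]
  rcases o with _ | l
  -- The last value determines everything but the input positions, which leaves a^k ≤ b^k routes;
  -- the first coordinate is a dummy.
  · refine Set.ncard_le_ncard_of_injOn
      (fun ω => (⟨0, ha⟩, fun m => Fin.castLE hab (ω.inPos m))) (fun _ _ => Set.mem_univ _) ?_
    intro ω hω ω' hω' h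
    have hlen : (ω.done E k).length = (ω'.done E k).length := by
      rw [length_done _ _ le_rfl, length_done _ _ le_rfl]
    obtain ⟨h1, h2⟩ := eq_of_done_eq
      (value_injective hT hcoef hlen (Eq.trans hω (Eq.symm hω'))).1
    have h3 : ω.inPos = ω'.inPos := by
      funext m
      exact Fin.castLE_injective hab (congrFun (Prod.ext_iff.1 h).2 m)
    cases ω; cases ω'
    simp only [Route.mk.injEq]
    exact ⟨h1, funext fun m => (h2 m m.2).1, h3, funext fun m => (h2 m m.2).2⟩
  -- Free are the input positions up to `l` and the output positions from `l` on: a^(l+1)·b^(k-l) ≤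
  -- a·b^k choices. Both kinds are stored in one function to `Fin b`.
  · refine Set.ncard_le_ncard_of_injOn
      (fun ω => (ω.inPos l, fun m => if m < l then Fin.castLE hab (ω.inPos m) else ω.outPos m))
      (fun _ _ => Set.mem_univ _) ?_
    intro ω hω ω' hω' h
    obtain ⟨h1, h2, h3⟩ := Meets.eq hT hcoef hω hω'
    obtain ⟨h4, h5⟩ := eq_of_done_eq h1
    have h6 := eq_of_todo_eq h2
    obtain ⟨h7, h8⟩ := Prod.ext_iff.1 h
    have h9 : ∀ m, (ω.comp m = ω'.comp m) ∧ ω.inPos m = ω'.inPos m ∧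
        ω.outPos m = ω'.outPos m := by
      intro m
      have h10 := congrFun h8 m
      rcases lt_trichotomy m l with hm | rfl | hm
      · simp only [hm, if_true] at h10
        exact ⟨(h5 m hm).1, Fin.castLE_injective hab h10, (h5 m hm).2⟩
      · simp only [lt_irrefl, if_false] at h10
        exact ⟨h3, h7, h10⟩
      · simp only [hm.not_gt, if_false] at h10
        exact ⟨(h6 m hm).1, (h6 m hm).2, h10⟩
    cases ω; cases ω'
    simp only [Route.mk.injEq]
    exact ⟨h4, funext fun m => (h9 m).1, funext fun m => (h9 m).2.1, funext fun m => (h9 m).2.2⟩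

/-- A route along which a property changes meets a vertex with a bad edge. -/
theorem exists_meets (hT : ∀ j, (T j).Draws (formSupport coef j)) (P bad : LinVertex T → Prop)
    (Q : List J → Prop)
    (h : ∀ u v : LinVertex T, u.Edge v → v.depth = d + k → (P u ↔ P v) ∨ bad u)
    (hQ : ∀ y : List J, y.length = d + k → (P (value T y []) ↔ Q y) ∨ bad (value T y []))
    (hω : ¬ (P (value T (ω.done E 0) (ω.todo E 0)) ↔ Q (ω.done E k))) :
    ∃ v o, bad v ∧ ω.Meets E T v o := by
  by_contra! hno
  have hstep : ∀ l ≤ k, (P (value T (ω.done E 0) (ω.todo E 0)) ↔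
      P (value T (ω.done E l) (ω.todo E l))) := by
    intro l
    induction l with
    | zero => exact fun _ => Iff.rfl
    | succ l ih =>
      intro hl
      refine (ih (by omega)).trans ?_
      by_contra hP
      have hl1 := done_succ E ω ⟨l, hl⟩
      have hl2 := todo_eq_cons E ω ⟨l, hl⟩
      simp only at hl1 hl2
      rw [hl1, hl2] at hP
      rcases E.exists_bad hT P bad (ω.done E l) (ω.todo E (l + 1)) (fun u v huv hv => h u v huv (by
        rw [hv, length_done _ _ (by omega), length_todo]; omega)) _ _ (by simp) hP with
        ⟨i', hi', hb⟩ | ⟨j', ν, hj', hb⟩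
      · exact hno _ (some ⟨l, hl⟩) hb (Or.inl ⟨i', by simpa using hi', rfl⟩)
      · exact hno _ (some ⟨l, hl⟩) hb (Or.inr ⟨j', ν, by simpa using hj', rfl⟩)
  rcases hQ (ω.done E k) (by rw [length_done _ _ le_rfl]; omega) with h1 | h1
  · have := hstep k le_rfl
    rw [todo_self] at this
    exact hω (this.trans h1)
  · exact hno _ none h1 rfl

theorem exists_done_eq (E : BalancedComponents coef C a b) (α : Fin k → Fin a) :
    ∀ y : List J, y.length = d + k →
      ∃ (q : Fin d → J) (c : Fin k → C) (β : Fin k → Fin b), (Route.mk q c α β).done E k = y := by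
  intro y hy
  obtain ⟨y1, y2, rfl, h1⟩ : ∃ y1 y2, y = y1 ++ y2 ∧ y1.length = k :=
    ⟨y.take k, y.drop k, (List.take_append_drop ..).symm, by simp; omega⟩
  have h2 : y2.length = d := by simp at hy; omega
  subst h2
  -- `done` lists the last letter first, so the outputs of the route are the letters of `y1` in
  -- reverse.
  obtain rfl : y1.reverse.length = k := by simpa using h1
  refine ⟨y2.get, fun m => (E.out (y1.reverse.get m)).1, fun m => (E.out (y1.reverse.get m)).2, ?_⟩
  have : (List.ofFn fun m => y1.reverse.get m) = y1.reverse := List.ofFn_get _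
  simp only [done, Prod.mk.eta, Equiv.symm_apply_apply, this, List.take_length,
    List.reverse_reverse, List.ofFn_get]

variable [Finite J] [Finite C]

instance : Finite (Route J C a b d k) := Finite.of_equiv _ (Route.equivProd J C a b d k).symm

/-- The input positions do not influence the end of a route, so every word is reached for each of
their a^k choices. -/
theorem pow_mul_ncard_le (E : BalancedComponents coef C a b) (Q : List J → Prop) :
    a ^ k * {y : List J | y.length = d + k ∧ Q y}.ncard ≤
      {ω : Route J C a b d k | Q (ω.done E k)}.ncard := by
  have h1 : a ^ k * {y : List J | y.length = d + k ∧ Q y}.ncard =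
      ((Set.univ : Set (Fin k → Fin a)) ×ˢ {y : List J | y.length = d + k ∧ Q y}).ncard := by
    rw [Set.ncard_prod]
    simp [Set.ncard_univ, Nat.card_eq_fintype_card]
  rw [h1]
  have h2 : ((Set.univ : Set (Fin k → Fin a)) ×ˢ {y : List J | y.length = d + k ∧ Q y}) ⊆
      (fun ω : Route J C a b d k => (ω.inPos, ω.done E k)) '' {ω | Q (ω.done E k)} := by
    rintro ⟨α, y⟩ ⟨-, hy, hQ⟩
    obtain ⟨q, c, β, rfl⟩ := exists_done_eq E α y hy
    exact ⟨_, hQ, rfl⟩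
  exact (Set.ncard_le_ncard h2 (Set.toFinite _)).trans (Set.ncard_image_le (Set.toFinite _))

open Classical in
/-- If less than half of the words have a property, then at least as many routes end at a word with
the property as there are routes whose ends are different. -/
theorem ncard_le_ncard_not_iff (E : BalancedComponents coef C a b) (P : LinVertex T → Prop)
    (Q : List J → Prop)
    (hhalf : 2 * {y : List J | y.length = d + k ∧ Q y}.ncard ≤ b ^ k) :
    {ω : Route J C a b d k | Q (ω.done E k)}.ncard ≤
      {ω : Route J C a b d k |
        ¬ (P (value T (ω.done E 0) (ω.todo E 0)) ↔ Q (ω.done E k))}.ncard := by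
  have := Fintype.ofFinite J
  have := Fintype.ofFinite C
  have : Fintype (Route J C a b d k) := Fintype.ofEquiv _ (Route.equivProd J C a b d k).symm
  have hcard : ∀ p : Route J C a b d k → Prop, {ω | p ω}.ncard =
      ∑ x, (Finset.univ.filter fun β => p ((Route.equivProd J C a b d k).symm (x, β))).card := by
    intro p
    rw [Set.ncard_eq_toFinset_card', Set.toFinset_ofPred, Finset.card_filter,
      ← (Route.equivProd J C a b d k).symm.sum_comp, Fintype.sum_prod_type]
    simp only [Finset.card_filter]
  rw [hcard, hcard]
  refine Finset.sum_le_sum fun x _ => ?_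
  obtain ⟨⟨q, c⟩, α⟩ := x
  have hfin : {y : List J | y.length = d + k ∧ Q y}.Finite :=
    (List.finite_length_eq J (d + k)).subset fun y hy => hy.1
  have hQ : (Finset.univ.filter fun β : Fin k → Fin b =>
      Q ((Route.mk q c α β).done E k)).card ≤ {y : List J | y.length = d + k ∧ Q y}.ncard := by
    rw [← Set.ncard_coe_finset]
    refine Set.ncard_le_ncard_of_injOn (fun β => (Route.mk q c α β).done E k) ?_ ?_ hfin
    · intro β hβ
      exact ⟨by rw [length_done _ _ le_rfl, add_comm], by simpa using hβ⟩
    · intro β _ β' _ h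
      exact funext fun m => ((eq_of_done_eq h).2 m m.2).2
  have h0 : ∀ β, value T ((Route.mk q c α β).done E 0) ((Route.mk q c α β).todo E 0) =
      value T (List.ofFn q) (List.ofFn fun m => E.inp.symm (c m, α m)) := by
    intro β; simp [done, todo]
  have hall : (Finset.univ.filter fun β : Fin k → Fin b =>
      Q ((Route.mk q c α β).done E k)).card + (Finset.univ.filter fun β : Fin k → Fin b =>
      ¬ Q ((Route.mk q c α β).done E k)).card = b ^ k := by
    rw [Finset.card_filter_add_card_filter_not]
    simp
  have hsymm : ∀ β, (Route.equivProd J C a b d k).symm (((q, c), α), β) = ⟨q, c, α, β⟩ :=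
    fun _ => rfl
  simp only [hsymm, h0]
  -- The start does not depend on β. If it has the property, the routes that change are those ending
  -- outside `Q`, at least half of all; otherwise they are exactly those ending in `Q`.
  by_cases hP : P (value T (List.ofFn q) (List.ofFn fun m => E.inp.symm (c m, α m)))
  · simp only [hP, true_iff]
    omega
  · simp [hP]

/-- The isoperimetric inequality for the recursive encoding graph. -/
theorem isoperimetric (E : BalancedComponents coef C a b)
    (hT : ∀ j, (T j).Draws (formSupport coef j))
    (hcoef : NoMultiplyCopied coef) (ha : 0 < a) (hab : a ≤ b)
    (P : LinVertex T → Prop) (B : Finset (LinVertex T)) (Q : List J → Prop)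
    (h : ∀ u v : LinVertex T, u.Edge v → v.depth = d + k → (P u ↔ P v) ∨ u ∈ B)
    (hQ : ∀ y : List J, y.length = d + k → (P (value T y []) ↔ Q y) ∨ value T y [] ∈ B)
    (hhalf : 2 * {y : List J | y.length = d + k ∧ Q y}.ncard ≤ b ^ k ∨
      ∀ y z, y.length = d → z.length = k → ¬ P (value T y z)) :
    a ^ k * {y : List J | y.length = d + k ∧ Q y}.ncard ≤ B.card * ((k + 1) * (a * b ^ k)) := by
  refine (pow_mul_ncard_le E Q).trans ?_
  have hlow : {ω : Route J C a b d k | Q (ω.done E k)}.ncard ≤ {ω : Route J C a b d k |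
      ¬ (P (value T (ω.done E 0) (ω.todo E 0)) ↔ Q (ω.done E k))}.ncard := by
    rcases hhalf with hhalf | hhalf
    · exact ncard_le_ncard_not_iff E P Q hhalf
    · refine Set.ncard_le_ncard (fun ω hω => ?_) (Set.toFinite _)
      have := hhalf (ω.done E 0) (ω.todo E 0) (by simp [done]) (by simp [todo])
      simp only [Set.mem_ofPred_eq] at hω ⊢
      tauto
  refine hlow.trans ?_
  -- Union bound over the vertices of `B` and k + 1 places: the k levels and the final value.
  have hsub : {ω : Route J C a b d k |
      ¬ (P (value T (ω.done E 0) (ω.todo E 0)) ↔ Q (ω.done E k))} ⊆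
      ⋃ x ∈ B ×ˢ (Finset.univ : Finset (Option (Fin k))), {ω | ω.Meets E T x.1 x.2} := by
    intro ω hω
    obtain ⟨v, o, hv, hm⟩ := exists_meets hT P (· ∈ B) Q h hQ hω
    exact Set.mem_biUnion (x := (v, o)) (by simpa using hv) hm
  refine (Set.ncard_le_ncard hsub (Set.toFinite _)).trans ?_
  refine (Finset.set_ncard_biUnion_le _ _).trans ?_
  refine (Finset.sum_le_card_nsmul _ _ _ fun x _ => ncard_meets_le hT hcoef ha hab x.1 x.2).trans ?_
  simp [Finset.card_product, mul_assoc]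

end Route
end Counting
/-! ### Executions -/

namespace CDAG

variable {V : Type} {G : CDAG V} {M : ℕ}

theorem run_append {s s' : Memory V} {σ τ : List (Move V)} :
    G.Run M s (σ ++ τ) s' ↔ ∃ s₁, G.Run M s σ s₁ ∧ G.Run M s₁ τ s' := by
  induction σ generalizing s with
  | nil =>
    constructor
    · exact fun h => ⟨s, .nil s, h⟩
    · rintro ⟨s₁, h, h'⟩
      cases h
      exact h'
  | cons x σ ih =>
    constructor
    · intro h
      cases h with
      | cons h hs =>
        obtain ⟨s₁, h₁, h₂⟩ := ih.1 hs
        exact ⟨s₁, .cons h h₁, h₂⟩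
    · rintro ⟨s₁, h, h'⟩
      cases h with
      | cons h hs => exact .cons h (ih.2 ⟨s₁, hs, h'⟩)

open Classical in
theorem Run.card_fast_le {s s' : Memory V} {σ : List (Move V)} (h : G.Run M s σ s')
    (hs : s.fast.card ≤ M) : s'.fast.card ≤ M := by
  induction h with
  | nil => exact hs
  | cons h _ ih =>
    refine ih ?_
    cases h with
    | read F L v hv hM => exact hM
    | write => exact hs
    | evict F L v => exact (Finset.card_le_card (Finset.erase_subset _ _)).trans hs
    | compute F F' L v hv hops hF hM => exact hM

open Classical in
theorem Run.mem_fast {s s' : Memory V} {σ : List (Move V)} (h : G.Run M s σ s') {u : V}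
    (hu : u ∈ s'.fast) : u ∈ s.fast ∨ Move.read u ∈ σ ∨ Move.compute u ∈ σ := by
  induction h with
  | nil => exact Or.inl hu
  | cons h _ ih =>
    rcases ih hu with h1 | h1 | h1
    · cases h with
      | read F L v hv hM =>
        rcases Finset.mem_insert.1 h1 with rfl | h1
        · simp
        · exact Or.inl h1
      | write => exact Or.inl h1
      | evict F L v => exact Or.inl (Finset.mem_of_mem_erase h1)
      | compute F F' L v hv hops hF hM =>
        rcases Finset.mem_insert.1 h1 with rfl | h1
        · simp
        · exact Or.inl (hF h1)
    · exact Or.inr (Or.inl (List.mem_cons_of_mem _ h1))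
    · exact Or.inr (Or.inr (List.mem_cons_of_mem _ h1))

theorem Run.mem_slow {s s' : Memory V} {σ : List (Move V)} (h : G.Run M s σ s') {u : V}
    (hu : u ∈ s'.slow) : u ∈ s.slow ∨ Move.write u ∈ σ := by
  induction h with
  | nil => exact Or.inl hu
  | cons h _ ih =>
    rcases ih hu with h1 | h1
    · cases h with
      | write F L v hv =>
        rcases Set.mem_insert_iff.1 h1 with rfl | h1
        · simp
        · exact Or.inl h1
      | read => exact Or.inl h1
      | evict => exact Or.inl h1
      | compute => exact Or.inl h1
    · exact Or.inr (List.mem_cons_of_mem _ h1)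

open Classical in
theorem Run.mem_fast_or_slow {s s' : Memory V} {σ : List (Move V)} (h : G.Run M s σ s') {u : V}
    (hu : u ∈ s'.fast ∨ u ∈ s'.slow) : (u ∈ s.fast ∨ u ∈ s.slow) ∨ Move.compute u ∈ σ := by
  induction h with
  | nil => exact Or.inl hu
  | cons h _ ih =>
    rcases ih hu with h1 | h1
    · cases h with
      | read F L v hv hM =>
        rcases h1 with h1 | h1
        · rcases Finset.mem_insert.1 h1 with rfl | h1
          · exact Or.inl (Or.inr hv)
          · exact Or.inl (Or.inl h1)
        · exact Or.inl (Or.inr h1)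
      | write F L v hv =>
        rcases h1 with h1 | h1
        · exact Or.inl (Or.inl h1)
        · rcases Set.mem_insert_iff.1 h1 with rfl | h1
          · exact Or.inl (Or.inl hv)
          · exact Or.inl (Or.inr h1)
      | evict F L v =>
        exact Or.inl (h1.imp_left fun h => Finset.mem_of_mem_erase h)
      | compute F F' L v hv hops hF hM =>
        rcases h1 with h1 | h1
        · rcases Finset.mem_insert.1 h1 with rfl | h1
          · simp
          · exact Or.inl (Or.inl (hF h1))
        · exact Or.inl (Or.inr h1)
    · exact Or.inr (List.mem_cons_of_mem _ h1)

/-- When an operation is performed, its operands are in fast memory. -/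
theorem Run.exists_of_compute {s s' : Memory V} {σ : List (Move V)} (h : G.Run M s σ s') {u v : V}
    (huv : G.edge u v) (hv : Move.compute v ∈ σ) :
    ∃ σ₁ σ₂ s₁, σ = σ₁ ++ Move.compute v :: σ₂ ∧ G.Run M s σ₁ s₁ ∧ u ∈ s₁.fast := by
  obtain ⟨σ₁, σ₂, rfl⟩ := List.append_of_mem hv
  obtain ⟨s₁, h₁, h₂⟩ := run_append.1 h
  refine ⟨σ₁, σ₂, s₁, rfl, h₁, ?_⟩
  cases h₂ with
  | cons h _ =>
    cases h with
    | compute F F' L v hv hops hF hM => exact hops u huv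

/-- The word that is transferred by a move, if any. -/
def _root_.RectMM.Move.transferred? : Move V → Option V
  | .read v => some v
  | .write v => some v
  | _ => none

open Classical in
/-- The words that are transferred by a sequence of moves. -/
def transferred (σ : List (Move V)) : Finset V := (σ.filterMap Move.transferred?).toFinset

theorem read_mem_transferred {σ : List (Move V)} {v : V} (h : Move.read v ∈ σ) :
    v ∈ transferred σ := by
  simp only [transferred, List.mem_toFinset, List.mem_filterMap]
  exact ⟨_, h, rfl⟩

theorem write_mem_transferred {σ : List (Move V)} {v : V} (h : Move.write v ∈ σ) :
    v ∈ transferred σ := by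
  simp only [transferred, List.mem_toFinset, List.mem_filterMap]
  exact ⟨_, h, rfl⟩

open Classical in
theorem card_transferred_le (σ : List (Move V)) :
    (transferred σ).card ≤ σ.countP Move.isTransfer := by
  refine (List.toFinset_card_le _).trans (le_of_eq ?_)
  induction σ with
  | nil => rfl
  | cons x σ ih =>
    cases x <;>
      simp [List.filterMap_cons, List.countP_cons, Move.transferred?, Move.isTransfer, ih]

theorem compute_mem_iff {σ : List (Move V)} {v : V} :
    v ∈ σ.filterMap Move.computed? ↔ Move.compute v ∈ σ := by
  rw [List.mem_filterMap]
  constructor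
  · rintro ⟨x, hx, h⟩
    cases x <;> simp [Move.computed?] at h
    rwa [← h]
  · exact fun h => ⟨_, h, rfl⟩

theorem not_compute_mem_of_nodup {σ τ : List (Move V)} {v : V}
    (h : ((σ ++ τ).filterMap Move.computed?).Nodup) (h₁ : Move.compute v ∈ σ) :
    Move.compute v ∉ τ := by
  rw [List.filterMap_append, List.nodup_append'] at h
  exact fun h₂ => h.2.2 (compute_mem_iff.2 h₁) (compute_mem_iff.2 h₂)

/-- In an execution, every operand that is not in the same part `τ` of the execution as the
operation is in fast memory at the beginning or at the end of `τ`, or is transferred during `τ`. -/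
theorem IsSchedule.exists_boundary {pre τ post : List (Move V)}
    (h : G.IsSchedule M (pre ++ τ ++ post)) (hdisj : Disjoint G.inputs G.ops) :
    ∃ B : Finset V, B.card ≤ 2 * M + τ.countP Move.isTransfer ∧
      ∀ u v, G.edge u v → v ∈ G.ops → (Move.compute u ∈ τ ↔ Move.compute v ∈ τ) ∨ u ∈ B := by
  classical
  obtain ⟨hnodup, hops, s₃, hrun, -⟩ := h
  obtain ⟨s₂, hrun', hpost⟩ := run_append.1 hrun
  obtain ⟨s₁, hpre, hτ⟩ := run_append.1 hrun'
  have h₁ : s₁.fast.card ≤ M := hpre.card_fast_le (by simp)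
  have h₂ : s₂.fast.card ≤ M := hτ.card_fast_le h₁
  -- The two fast memories contribute the `2 * M`.
  refine ⟨s₁.fast ∪ s₂.fast ∪ transferred τ, ?_, ?_⟩
  · have := card_transferred_le τ
    have := Finset.card_union_le (s₁.fast ∪ s₂.fast) (transferred τ)
    have := Finset.card_union_le s₁.fast s₂.fast
    omega
  intro u v huv hv
  simp only [Finset.mem_union]
  have hinp : Move.compute u ∈ τ → u ∉ G.inputs := fun hu hi =>
    Set.disjoint_left.1 hdisj hi ((hops u).1 (compute_mem_iff.2 (by simp [hu])))
  have hpreτ : Move.compute u ∈ pre → Move.compute u ∉ τ := fun h => by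
    rw [List.append_assoc] at hnodup
    exact fun h' => not_compute_mem_of_nodup hnodup h (List.mem_append_left _ h')
  have hτpost : Move.compute u ∈ τ → Move.compute u ∉ post := fun h =>
    not_compute_mem_of_nodup hnodup (List.mem_append_right _ h)
  by_cases hvτ : Move.compute v ∈ τ
  · by_cases huτ : Move.compute u ∈ τ
    · exact Or.inl (iff_of_true huτ hvτ)
    right
    obtain ⟨τ₁, τ₂, s, rfl, hs, hus⟩ := hτ.exists_of_compute huv hvτ
    rcases hs.mem_fast hus with h | h | h
    · exact Or.inl (Or.inl h)
    · exact Or.inr (read_mem_transferred (List.mem_append_left _ h))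
    · exact absurd (List.mem_append_left _ h) huτ
  by_cases huτ : Move.compute u ∈ τ
  swap
  · exact Or.inl (iff_of_false huτ hvτ)
  right
  have hvσ := compute_mem_iff.1 ((hops v).2 hv)
  simp only [List.mem_append, hvτ, or_false] at hvσ
  -- If `v` came before `τ`, then `u` would be present before its only computation without being an
  -- input. If `v` comes after `τ`, then `u` leaves `τ` in fast memory or in slow memory, and in the
  -- latter case it was written during `τ`.
  rcases hvσ with hvσ | hvσ
  · obtain ⟨p₁, p₂, s, rfl, hs, hus⟩ := hpre.exists_of_compute huv hvσ
    rcases hs.mem_fast_or_slow (Or.inl hus) with (h | h) | h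
    · simp at h
    · exact absurd h (hinp huτ)
    · exact absurd huτ (hpreτ (List.mem_append_left _ h))
  · obtain ⟨p₁, p₂, s, rfl, hs, hus⟩ := hpost.exists_of_compute huv hvσ
    rcases hs.mem_fast_or_slow (Or.inl hus) with (h | h) | h
    · exact Or.inl (Or.inr h)
    · rcases hτ.mem_slow h with h | h
      · rcases hpre.mem_fast_or_slow (Or.inr h) with (h | h) | h
        · simp at h
        · exact absurd h (hinp huτ)
        · exact absurd huτ (hpreτ h)
      · exact Or.inr (write_mem_transferred h)
    · exact absurd (List.mem_append_left _ h) (hτpost huτ)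

/-- In an execution, every operand that is not an operation is transferred. -/
theorem IsSchedule.mem_ops_or_transferred {σ : List (Move V)} (h : G.IsSchedule M σ) {u v : V}
    (huv : G.edge u v) (hv : v ∈ G.ops) : u ∈ G.ops ∨ u ∈ transferred σ := by
  obtain ⟨-, hops, s', hrun, -⟩ := h
  obtain ⟨σ₁, σ₂, s, rfl, hs, hus⟩ :=
    hrun.exists_of_compute huv (compute_mem_iff.1 ((hops v).2 hv))
  rcases hs.mem_fast hus with h | h | h
  · simp at h
  · exact Or.inr (read_mem_transferred (List.mem_append_left _ h))
  · exact Or.inl ((hops u).1 (compute_mem_iff.2 (List.mem_append_left _ h)))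

end CDAG

/-- If every part of a list with exactly `s` elements of one kind has at least `w` elements of
another kind, then the list has at least `w` elements of the other kind for every `s` elements of
the first kind. -/
theorem mul_div_countP_le {α : Type*} (p r : α → Bool) (s w : ℕ) (σ : List α)
    (h : ∀ pre τ post, σ = pre ++ τ ++ post → τ.countP p = s → w ≤ τ.countP r) :
    w * (σ.countP p / s) ≤ σ.countP r := by
  obtain ⟨n, hn⟩ : ∃ n, n = σ.countP p / s := ⟨_, rfl⟩
  rw [← hn]
  have hns : n * s ≤ σ.countP p := hn ▸ Nat.div_mul_le_self _ _
  clear hn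
  induction n generalizing σ with
  | zero => simp
  | succ n ih =>
    obtain ⟨τ, ρ, rfl, hτ⟩ : ∃ τ ρ, σ = τ ++ ρ ∧ τ.countP p = s := by
      have hs : s ≤ σ.countP p := le_trans (Nat.le_mul_of_pos_left _ n.succ_pos) hns
      clear h hns ih
      induction σ generalizing s with
      | nil => exact ⟨[], [], rfl, by simp at hs ⊢; omega⟩
      | cons x σ ih =>
        rcases Nat.eq_zero_or_pos s with rfl | hs0
        · exact ⟨[], _, rfl, rfl⟩
        by_cases hx : p x
        · rw [List.countP_cons_of_pos hx] at hs
          obtain ⟨τ, ρ, rfl, h⟩ := ih (s - 1) (by omega)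
          exact ⟨x :: τ, ρ, rfl, by rw [List.countP_cons_of_pos hx, h]; omega⟩
        · rw [List.countP_cons_of_neg hx] at hs
          obtain ⟨τ, ρ, rfl, h⟩ := ih s hs
          exact ⟨x :: τ, ρ, rfl, by rw [List.countP_cons_of_neg hx, h]⟩
    have h₁ := h [] τ ρ rfl hτ
    have h₂ := ih ρ (fun pre τ' post e hc => h (τ ++ pre) τ' post (by simp [e]) hc) (by
      rw [List.countP_append, hτ] at hns
      have : (n + 1) * s = n * s + s := by ring
      omega)
    rw [List.countP_append]
    have : w * (n + 1) = w * n + w := by ring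
    omega

/-! ### The number of multiplications -/

section Rank

open Polynomial

variable {R : Type*} [CommRing R]

/-- The matrix `1 + X F` over a polynomial ring is injective. -/
theorem eq_zero_of_add_X_mul_sum_eq_zero {ι : Type*} [Fintype ι] (P : ι → R[X])
    (F : ι → ι → R[X]) (h : ∀ x, P x + X * ∑ y, P y * F x y = 0) : P = 0 := by
  -- The equation reads P = -X·(…), so each divisibility by a power of `X` improves by one.
  have hdvd : ∀ n : ℕ, ∀ x, X ^ n ∣ P x := by
    intro n
    induction n with
    | zero => simp
    | succ n ih =>
      intro x
      rw [eq_neg_of_add_eq_zero_left (h x), dvd_neg, pow_succ']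
      exact mul_dvd_mul_left _ (Finset.dvd_sum fun y _ => (ih y).mul_right _)
  funext x
  ext n
  exact X_pow_dvd_iff.1 (hdvd (n + 1) x) n n.lt_succ_self

/-- The same for Laurent polynomials. -/
theorem eq_zero_of_add_T_mul_sum_eq_zero {ι : Type*} [Fintype ι] (v : ι → R[T;T⁻¹])
    (F : ι → ι → R[X])
    (h : ∀ x, v x + LaurentPolynomial.T 1 * ∑ y, v y * toLaurent (F x y) = 0) : v = 0 := by
  choose n f hf using fun x => LaurentPolynomial.exists_T_pow (v x)
  -- Multiplication by `T N` clears all negative exponents at once.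
  let N := ∑ x, n x
  have hle : ∀ x, n x ≤ N := fun x =>
    Finset.single_le_sum (f := n) (fun _ _ => Nat.zero_le _) (Finset.mem_univ x)
  have hP : ∀ x, toLaurent (f x * X ^ (N - n x)) = v x * LaurentPolynomial.T N := by
    intro x
    rw [map_mul, hf, toLaurent_X_pow, mul_assoc, ← LaurentPolynomial.T_add]
    congr 2
    have := hle x
    omega
  have hP0 := eq_zero_of_add_X_mul_sum_eq_zero (fun x => f x * X ^ (N - n x)) F (by
    intro x
    apply toLaurent_injective
    simp only [map_add, map_sum, map_zero, toLaurent_X, hP, map_mul toLaurent X,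
      map_mul toLaurent (f _ * X ^ _)]
    have := congrArg (· * LaurentPolynomial.T (N : ℤ)) (h x)
    simp only [zero_mul, add_mul, mul_assoc, Finset.sum_mul] at this
    rw [← this]
    congr 2
    refine Finset.sum_congr rfl fun y _ => ?_
    ring)
  funext x
  have := congrArg toLaurent (congrFun hP0 x)
  simp only [Pi.zero_apply, map_zero] at this
  rw [hP] at this
  exact (LaurentPolynomial.isUnit_T (R := R) N).mul_left_eq_zero.1 this

/-- If the inputs can be recovered from the values of the forms up to terms of positive order, then
there are at least as many forms as inputs. -/
theorem card_le_of_recover [Nontrivial R] {I J : Type*} [Fintype I] [Fintype J] [DecidableEq I]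
    (coef : J → I → R[T;T⁻¹]) (g : I → J → R[T;T⁻¹]) (F : I → I → R[X])
    (h : ∀ x y, ∑ r, g x r * coef r y =
      (if x = y then 1 else 0) + LaurentPolynomial.T 1 * toLaurent (F x y)) :
    Fintype.card I ≤ Fintype.card J := by
  refine card_le_of_injective R[T;T⁻¹] (Matrix.mulVecLin (Matrix.of coef)) ?_
  rw [← LinearMap.ker_eq_bot, LinearMap.ker_eq_bot']
  intro v hv
  refine eq_zero_of_add_T_mul_sum_eq_zero v F fun x => ?_
  have hv' : ∀ r, ∑ y, coef r y * v y = 0 := fun r => by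
    simpa [Matrix.mulVec, dotProduct] using congrFun hv r
  have h1 : ∑ y, (∑ r, g x r * coef r y) * v y = 0 := by
    simp only [Finset.sum_mul]
    rw [Finset.sum_comm]
    simp only [mul_assoc, ← Finset.mul_sum, hv', mul_zero, Finset.sum_const_zero]
  simp only [h, add_mul, Finset.sum_add_distrib, ite_mul, one_mul, zero_mul, Finset.sum_ite_eq,
    Finset.mem_univ, if_true] at h1
  rw [← h1, Finset.mul_sum]
  congr 1
  exact Finset.sum_congr rfl fun y _ => by ring

variable {m n p q : ℕ} {alg : BilinearAlgorithm R m n p q}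

theorem sum_mul_C_single {ι κ : Type*} [Fintype ι] [Fintype κ] [DecidableEq ι] [DecidableEq κ]
    (c : ι × κ → R[T;T⁻¹]) (i : ι) (k : κ) :
    ∑ x : ι × κ, c x * LaurentPolynomial.C (Matrix.single i k (1 : R) x.1 x.2) = c (i, k) := by
  rw [Finset.sum_eq_single (i, k)]
  · simp
  · intro x _ hx
    rw [Matrix.single_apply_of_ne, map_zero, mul_zero]
    rintro ⟨rfl, rfl⟩
    exact hx rfl
  · simp

/-- Letting the second factor be a matrix unit in a fixed column `l` makes every entry of the first
factor an entry of the product. So the `q` forms determine the first factor up to positive order,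
and there are at least `m * n` of them. -/
theorem BilinearAlgorithm.Correct.mul_le_of_pos_right [Nontrivial R] (h : alg.Correct)
    (hp : 0 < p) : m * n ≤ q := by
  let l : Fin p := ⟨0, hp⟩
  choose f hf using h
  have := card_le_of_recover alg.encA (fun x r => alg.decC (x.1, l) r * alg.encB r (x.2, l))
    (fun x y => f (Matrix.single y.1 y.2 1) (Matrix.single x.2 l 1) (x.1, l))
    (by
      intro x y
      have h1 := hf (Matrix.single y.1 y.2 1) (Matrix.single x.2 l 1) (x.1, l)
      simp only [BilinearAlgorithm.eval, sum_mul_C_single] at h1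
      have h2 : (Matrix.single y.1 y.2 (1 : R) * Matrix.single x.2 l (1 : R)) x.1 l =
          if x = y then 1 else 0 := by
        rw [Matrix.mul_apply, Finset.sum_eq_single x.2]
        · simp [Matrix.single_apply, Prod.ext_iff, eq_comm]
        · intro j _ hj
          simp [Matrix.single_apply, hj.symm]
        · simp
      rw [h2] at h1
      rw [← (show LaurentPolynomial.C (if x = y then (1 : R) else 0) = if x = y then 1 else 0 by
        split <;> simp), ← h1]
      exact Finset.sum_congr rfl fun r _ => by ring)
  simpa using this

theorem BilinearAlgorithm.Correct.mul_le_of_pos_left [Nontrivial R] (h : alg.Correct)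
    (hm : 0 < m) : n * p ≤ q := by
  let l : Fin m := ⟨0, hm⟩
  choose f hf using h
  have := card_le_of_recover alg.encB (fun x r => alg.decC (l, x.2) r * alg.encA r (l, x.1))
    (fun x y => f (Matrix.single l x.1 1) (Matrix.single y.1 y.2 1) (l, x.2))
    (by
      intro x y
      have h1 := hf (Matrix.single l x.1 1) (Matrix.single y.1 y.2 1) (l, x.2)
      simp only [BilinearAlgorithm.eval, sum_mul_C_single] at h1
      have h2 : (Matrix.single l x.1 (1 : R) * Matrix.single y.1 y.2 (1 : R)) l x.2 =
          if x = y then 1 else 0 := by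
        rw [Matrix.mul_apply, Finset.sum_eq_single x.1]
        · simp [Matrix.single_apply, Prod.ext_iff, eq_comm]
        · intro j _ hj
          simp [Matrix.single_apply, hj.symm]
        · simp
      rw [h2] at h1
      rw [← (show LaurentPolynomial.C (if x = y then (1 : R) else 0) = if x = y then 1 else 0 by
        split <;> simp), ← h1]
      exact Finset.sum_congr rfl fun r _ => by ring)
  simpa using this

end Rank

/-! ### Numbering the components -/

theorem exists_equiv_prod_fin {I C : Type*} [Finite I] (f : I → C) (a : ℕ)
    (h : ∀ c, {i | f i = c}.ncard = a) : ∃ e : I ≃ C × Fin a, ∀ i, (e i).1 = f i := by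
  have h' : ∀ c, Nonempty ({i // f i = c} ≃ Fin a) := fun c =>
    ⟨Finite.equivFinOfCardEq (by rw [← h c]; exact Nat.card_coe_set_eq {i | f i = c})⟩
  exact ⟨((Equiv.sigmaFiberEquiv f).symm.trans (Equiv.sigmaCongrRight fun c => (h' c).some)).trans
    (Equiv.sigmaEquivProd C (Fin a)), fun i => rfl⟩

theorem HasEqualComponents.exists_balancedComponents {S I J : Type*} [Zero S] [Finite I] [Finite J]
    [Nonempty I] {coef : J → I → S} {X : ℕ} (h : HasEqualComponents coef X) :
    ∃ a b, Nonempty (BalancedComponents coef (formGraph coef).ConnectedComponent a b) ∧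
      Nat.card I = X * a ∧ Nat.card J = X * b := by
  obtain ⟨i₀⟩ := ‹Nonempty I›
  -- The common sizes `a` and `b` are read off at the component of some input.
  let c₀ := (formGraph coef).connectedComponentMk (Sum.inl i₀)
  obtain ⟨e, he⟩ := exists_equiv_prod_fin
    (fun i : I => (formGraph coef).connectedComponentMk (Sum.inl i))
    {i : I | Sum.inl i ∈ c₀.supp}.ncard (fun c => (h.2 c c₀).1)
  obtain ⟨e', he'⟩ := exists_equiv_prod_fin
    (fun j : J => (formGraph coef).connectedComponentMk (Sum.inr j))
    {j : J | Sum.inr j ∈ c₀.supp}.ncard (fun c => (h.2 c c₀).2)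
  refine ⟨_, _, ⟨⟨e, e', ?_, ?_⟩⟩, ?_, ?_⟩
  · intro i j hij
    rw [he, he']
    exact SimpleGraph.ConnectedComponent.sound (formGraph_adj_iff.2 hij).reachable
  · intro i j hij
    rw [he, he'] at hij
    exact SimpleGraph.ConnectedComponent.exact hij
  · rw [Nat.card_congr e, Nat.card_prod, h.1, Nat.card_fin]
  · rw [Nat.card_congr e', Nat.card_prod, h.1, Nat.card_fin]

/-! ### Encoding graphs inside computational graphs -/

/-- The depth-`t` recursive encoding graph inside a computational graph in which every output of the
encoding graph is an operand of an operation of its own. -/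
structure EncodingEmbedding {I J V : Type} (T : J → SumTree I) (G : CDAG V) (t : ℕ) where
  vert : LinVertex T → V
  mul : List J → V
  vert_injective : Function.Injective vert
  mul_injective : Function.Injective mul
  edge : ∀ {u v : LinVertex T}, u.Edge v → G.edge (vert u) (vert v)
  edge_mul : ∀ y, G.edge (vert (LinVertex.value T y [])) (mul y)
  vert_mem_ops : ∀ {u v : LinVertex T}, u.Edge v → v.depth = t → vert v ∈ G.ops
  mul_mem_ops : ∀ {y : List J}, y.length = t → mul y ∈ G.ops
  input_notMem_ops : ∀ z, vert (LinVertex.input z) ∉ G.ops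
  disjoint : Disjoint G.inputs G.ops

namespace EncodingEmbedding

variable {I J V : Type} {T : J → SumTree I} {G : CDAG V} {t : ℕ}

open Classical in
/-- Whether a move performs one of the operations that use the outputs of the encoding graph. -/
def isMul (Φ : EncodingEmbedding T G t) (x : Move V) : Bool :=
  decide (∃ y : List J, y.length = t ∧ x = Move.compute (Φ.mul y))

theorem isMul_iff {Φ : EncodingEmbedding T G t} {x : Move V} :
    Φ.isMul x = true ↔ ∃ y : List J, y.length = t ∧ x = Move.compute (Φ.mul y) := by
  simp [isMul]

/-- No operation is repeated, so words and moves are counted alike. -/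
theorem ncard_mul_eq_countP (Φ : EncodingEmbedding T G t) {τ : List (Move V)}
    (hτ : (τ.filterMap Move.computed?).Nodup) :
    {y : List J | y.length = t ∧ Move.compute (Φ.mul y) ∈ τ}.ncard = τ.countP Φ.isMul := by
  classical
  have hnodup : (τ.filter Φ.isMul).Nodup := by
    induction τ with
    | nil => simp
    | cons x τ ih =>
      have hτ' : (τ.filterMap Move.computed?).Nodup :=
        hτ.sublist ((List.sublist_cons_self x τ).filterMap _)
      by_cases hx : Φ.isMul x
      · rw [List.filter_cons_of_pos hx, List.nodup_cons]
        refine ⟨fun h => ?_, ih hτ'⟩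
        obtain ⟨y, -, rfl⟩ := isMul_iff.1 hx
        exact CDAG.not_compute_mem_of_nodup (σ := [Move.compute (Φ.mul y)]) hτ (by simp)
          (List.mem_of_mem_filter h)
      · rw [List.filter_cons_of_neg hx]
        exact ih hτ'
  have himage : (fun y => Move.compute (Φ.mul y)) ''
      {y : List J | y.length = t ∧ Move.compute (Φ.mul y) ∈ τ} =
      ((τ.filter Φ.isMul).toFinset : Set (Move V)) := by
    ext x
    simp only [Set.mem_image, Set.mem_ofPred_eq, List.coe_toFinset, List.mem_filter, isMul_iff]
    constructor
    · rintro ⟨y, ⟨h1, h2⟩, rfl⟩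
      exact ⟨h2, y, h1, rfl⟩
    · rintro ⟨h, y, hy, rfl⟩
      exact ⟨y, ⟨hy, h⟩, rfl⟩
  rw [← Set.ncard_image_of_injective _ (f := fun y => Move.compute (Φ.mul y))
    (fun y y' h => Φ.mul_injective (Move.compute.inj h)), himage, Set.ncard_coe_finset,
    List.toFinset_card_of_nodup hnodup, List.countP_eq_length_filter]

theorem countP_isMul [Finite J] (Φ : EncodingEmbedding T G t) {M : ℕ} {σ : List (Move V)}
    (hσ : G.IsSchedule M σ) : σ.countP Φ.isMul = Nat.card J ^ t := by
  rw [← Φ.ncard_mul_eq_countP hσ.1]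
  have : {y : List J | y.length = t ∧ Move.compute (Φ.mul y) ∈ σ} = {y : List J | y.length = t} := by
    ext y
    exact and_iff_left_of_imp fun hy => CDAG.compute_mem_iff.1 ((hσ.2.1 _).2 (Φ.mul_mem_ops hy))
  rw [this, ← Nat.card_coe_set_eq]
  have := Fintype.ofFinite J
  have hv : Nat.card (List.Vector J t) = Nat.card J ^ t := by
    rw [Nat.card_eq_fintype_card, card_vector, Nat.card_eq_fintype_card]
  exact hv

/-! ### Lower bounds for the transfers of an execution -/

variable {S : Type*} [Zero S] {coef : J → I → S} {C : Type} [Finite J] [Finite C] {a b : ℕ}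

/-- The cost of a part of an execution, in terms of the number of multiplications in it. -/
theorem pow_mul_countP_le (Φ : EncodingEmbedding T G t) (E : BalancedComponents coef C a b)
    (hT : ∀ j, (T j).Draws (formSupport coef j)) (hcoef : NoMultiplyCopied coef)
    (ha : 0 < a) (hab : a ≤ b) {M k : ℕ} (hk : k ≤ t) {pre τ post : List (Move V)}
    (hσ : G.IsSchedule M (pre ++ τ ++ post)) (hhalf : 2 * τ.countP Φ.isMul ≤ b ^ k) :
    a ^ k * τ.countP Φ.isMul ≤
      (2 * M + τ.countP Move.isTransfer) * ((k + 1) * (a * b ^ k)) := by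
  obtain ⟨B, hB, hedge⟩ := hσ.exists_boundary Φ.disjoint
  have hτ : (τ.filterMap Move.computed?).Nodup :=
    hσ.1.sublist (((List.sublist_append_right pre τ).trans
      (List.sublist_append_left _ post)).filterMap _)
  have hcard := Φ.ncard_mul_eq_countP hτ
  have hdk : t - k + k = t := Nat.sub_add_cancel hk
  -- The block consists of the last k levels, so that its outputs feed the multiplications.
  have h := Route.isoperimetric (d := t - k) (k := k) E hT hcoef ha hab
    (fun u => Move.compute (Φ.vert u) ∈ τ) (B.preimage Φ.vert Φ.vert_injective.injOn)
    (fun y => Move.compute (Φ.mul y) ∈ τ)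
    (fun u v huv hv => by
      simpa using hedge _ _ (Φ.edge huv) (Φ.vert_mem_ops huv (hv.trans hdk)))
    (fun y hy => by
      simpa using hedge _ _ (Φ.edge_mul y) (Φ.mul_mem_ops (hy.trans hdk)))
    (Or.inl (by rw [hdk, hcard]; exact hhalf))
  rw [hdk, hcard] at h
  refine h.trans (Nat.mul_le_mul_right _ (le_trans ?_ hB))
  exact Finset.card_le_card_of_injOn Φ.vert (fun u hu => by simpa using hu)
    Φ.vert_injective.injOn

/-- The cost of an execution, as every input has to be read. -/
theorem pow_mul_pow_le (Φ : EncodingEmbedding T G t) (E : BalancedComponents coef C a b)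
    (hT : ∀ j, (T j).Draws (formSupport coef j)) (hcoef : NoMultiplyCopied coef)
    (ha : 0 < a) (hab : a ≤ b) {M : ℕ} {σ : List (Move V)} (hσ : G.IsSchedule M σ) :
    a ^ t * Nat.card J ^ t ≤ σ.countP Move.isTransfer * ((t + 1) * (a * b ^ t)) := by
  have hedge : ∀ {u v}, G.edge u v → v ∈ G.ops →
      (u ∈ G.ops ↔ v ∈ G.ops) ∨ u ∈ CDAG.transferred σ := fun huv hv =>
    (hσ.mem_ops_or_transferred huv hv).imp_left fun hu => iff_of_true hu hv
  -- Inputs are not operations and all multiplications are, so every route changes status and no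
  -- bound on the number of words is needed.
  have h := Route.isoperimetric (d := 0) (k := t) E hT hcoef ha hab (fun u => Φ.vert u ∈ G.ops)
    ((CDAG.transferred σ).preimage Φ.vert Φ.vert_injective.injOn)
    (fun y => Φ.mul y ∈ G.ops)
    (fun u v huv hv => by
      simpa using hedge (Φ.edge huv) (Φ.vert_mem_ops huv (hv.trans (zero_add t))))
    (fun y hy => by
      simpa using hedge (Φ.edge_mul y) (Φ.mul_mem_ops (hy.trans (zero_add t))))
    (Or.inr fun y z hy _ => by
      rw [List.length_eq_zero_iff.1 hy]
      exact Φ.input_notMem_ops z)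
  have hset : {y : List J | y.length = 0 + t ∧ Φ.mul y ∈ G.ops} =
      {y : List J | y.length = t ∧ Move.compute (Φ.mul y) ∈ σ} := by
    ext y
    rw [Set.mem_ofPred_eq, Set.mem_ofPred_eq, zero_add, ← hσ.2.1, CDAG.compute_mem_iff]
  rw [hset, Φ.ncard_mul_eq_countP hσ.1, Φ.countP_isMul hσ] at h
  refine h.trans (Nat.mul_le_mul_right _ (le_trans ?_ (CDAG.card_transferred_le σ)))
  exact Finset.card_le_card_of_injOn Φ.vert (fun u hu => by simpa using hu)
    Φ.vert_injective.injOn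

/-- The cost of an execution, from its parts with `b ^ k / 2` multiplications. -/
theorem mul_div_le (Φ : EncodingEmbedding T G t) (E : BalancedComponents coef C a b)
    (hT : ∀ j, (T j).Draws (formSupport coef j)) (hcoef : NoMultiplyCopied coef)
    (ha : 2 ≤ a) (hab : a ≤ b) {M k : ℕ} (hk₀ : k ≠ 0) (hk : k ≤ t)
    (hM : 12 * a * (k + 1) * M ≤ a ^ k) {σ : List (Move V)} (hσ : G.IsSchedule M σ) :
    M * (Nat.card J ^ t / (b ^ k / 2)) ≤ σ.countP Move.isTransfer := by
  rw [← Φ.countP_isMul hσ]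
  refine mul_div_countP_le _ _ _ _ _ ?_
  rintro pre τ post rfl hτ
  have hbk : 2 ≤ b ^ k := (ha.trans hab).trans (Nat.le_self_pow hk₀ b)
  have h := Φ.pow_mul_countP_le E hT hcoef (by omega) hab hk hσ (by omega)
  rw [hτ] at h
  set w := τ.countP Move.isTransfer
  -- Rounding is harmless as b^k ≥ 2. The constant 12 = 4·3 leaves 3M ≤ 2M + w.
  have h4 : b ^ k ≤ 4 * (b ^ k / 2) := by omega
  have h5 : (12 * a * (k + 1) * M) * b ^ k ≤ (4 * a * (k + 1) * (2 * M + w)) * b ^ k :=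
    calc (12 * a * (k + 1) * M) * b ^ k ≤ a ^ k * (4 * (b ^ k / 2)) := Nat.mul_le_mul hM h4
      _ = 4 * (a ^ k * (b ^ k / 2)) := by ring
      _ ≤ 4 * ((2 * M + w) * ((k + 1) * (a * b ^ k))) := Nat.mul_le_mul_left _ h
      _ = _ := by ring
  have h6 := Nat.le_of_mul_le_mul_right h5 (by omega)
  have h7 : (4 * a * (k + 1)) * (3 * M) ≤ (4 * a * (k + 1)) * (2 * M + w) := by
    refine le_trans (le_of_eq ?_) h6
    ring
  have := Nat.le_of_mul_le_mul_left h7 (by positivity)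
  omega

end EncodingEmbedding

/-! ### The choice of the depth of the blocks -/

theorem real_bound {a b q t M w : ℕ} (ha : 2 ≤ a) (hab : a ≤ b) (hbq : b ≤ q) (ht : 1 ≤ t)
    (hM : 1 ≤ M) (hA : a ^ t * q ^ t ≤ w * ((t + 1) * (a * b ^ t)))
    (hB : ∀ k, k ≠ 0 → k ≤ t → 12 * a * (k + 1) * M ≤ a ^ k → M * (q ^ t / (b ^ k / 2)) ≤ w) :
    ((24 * (a : ℝ) ^ 2) ^ Real.logb a b)⁻¹ *
      ((q : ℝ) ^ t / ((t : ℝ) ^ Real.logb a b * (M : ℝ) ^ (Real.logb a b - 1))) ≤ w := by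
  set ω := Real.logb a b with hω
  have ha' : (2 : ℝ) ≤ a := by exact_mod_cast ha
  have ht' : (1 : ℝ) ≤ t := by exact_mod_cast ht
  have hM' : (1 : ℝ) ≤ M := by exact_mod_cast hM
  have hab' : (a : ℝ) ≤ b := by exact_mod_cast hab
  have ha0 : (0 : ℝ) < a := by linarith
  have ht0 : (0 : ℝ) < t := by linarith
  have hM0 : (0 : ℝ) < M := by linarith
  have hb0 : (0 : ℝ) < b := by linarith
  have hq0 : (0 : ℝ) < q := lt_of_lt_of_le hb0 (by exact_mod_cast hbq)
  have hω1 : 1 ≤ ω := by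
    rw [hω, Real.le_logb_iff_rpow_le (by linarith) hb0, Real.rpow_one]
    exact hab'
  have hpow : ∀ k : ℕ, (b : ℝ) ^ k = ((a : ℝ) ^ k) ^ ω := by
    intro k
    rw [← Real.rpow_natCast_mul ha0.le, mul_comm, Real.rpow_mul_natCast ha0.le, hω,
      Real.rpow_logb ha0 (by linarith) hb0]
  have hMω : (M : ℝ) ^ ω = M ^ (ω - 1) * M := by
    rw [Real.rpow_sub_one hM0.ne']; field_simp
  -- As k + 1 ≤ 2t for k ≤ t, this implies the hypothesis 12a(k+1)M ≤ a^k of `hB`; minimality of k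
  -- bounds b^k from above.
  have hex : ∃ k, 24 * a * t * M ≤ a ^ k := by
    obtain ⟨k, hk⟩ := pow_unbounded_of_one_lt (24 * a * t * M) (show 1 < a by omega)
    exact ⟨k, hk.le⟩
  classical
  set k := Nat.find hex with hkdef
  have hk := Nat.find_spec hex
  rw [← hkdef] at hk
  by_cases hkt : k ≤ t
  · have hk0 : k ≠ 0 := by
      intro h0
      rw [h0, pow_zero] at hk
      have : 1 ≤ a * t * M := Nat.one_le_iff_ne_zero.2 (by positivity)
      have : 24 * a * t * M = 24 * (a * t * M) := by ring
      omega
    have hlt : a ^ (k - 1) < 24 * a * t * M := by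
      have := Nat.find_min hex (m := k - 1) (by omega)
      omega
    have hup : (a : ℝ) ^ k ≤ 24 * a ^ 2 * (t * M) := by
      have h1 : (a : ℝ) ^ (k - 1) ≤ 24 * a * t * M := by exact_mod_cast hlt.le
      calc (a : ℝ) ^ k = a * a ^ (k - 1) := by
            rw [← pow_succ', Nat.sub_add_cancel (Nat.one_le_iff_ne_zero.2 hk0)]
        _ ≤ a * (24 * a * t * M) := by gcongr
        _ = _ := by ring
    have hbk : (b : ℝ) ^ k ≤ (24 * (a : ℝ) ^ 2) ^ ω * ((t : ℝ) ^ ω * (M : ℝ) ^ ω) := by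
      rw [hpow, ← Real.mul_rpow ht0.le hM0.le, ← Real.mul_rpow (by positivity) (by positivity)]
      exact Real.rpow_le_rpow (by positivity) hup (by linarith)
    have hw := hB k hk0 hkt (le_trans (by
      have h2 : k + 1 ≤ 2 * t := by omega
      calc 12 * a * (k + 1) * M ≤ 12 * a * (2 * t) * M := by gcongr
        _ = _ := by ring) hk)
    have hs : 2 ≤ b ^ k := (ha.trans hab).trans (Nat.le_self_pow hk0 b)
    have hsq : b ^ k / 2 ≤ q ^ t := by
      have h1 : b ^ k ≤ q ^ k := Nat.pow_le_pow_left hbq k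
      have h2 : q ^ k ≤ q ^ t := Nat.pow_le_pow_right (by omega) hkt
      omega
    -- The quotient `D` is at least 1, so D + 1 ≤ 2D, and this factor 2 cancels the one in b^k / 2.
    have hfl : q ^ t ≤ (q ^ t / (b ^ k / 2)) * b ^ k := by
      have h1 : 1 ≤ q ^ t / (b ^ k / 2) := (Nat.one_le_div_iff (by omega)).2 hsq
      have h2 := Nat.lt_mul_div_succ (q ^ t) (show 0 < b ^ k / 2 by omega)
      set D := q ^ t / (b ^ k / 2)
      calc q ^ t ≤ (b ^ k / 2) * (D + 1) := h2.le
        _ ≤ (b ^ k / 2) * (D * 2) := by gcongr; omega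
        _ = D * (b ^ k / 2 * 2) := by ring
        _ ≤ _ := by gcongr; omega
    have hfl' : (q : ℝ) ^ t * M ≤ w * b ^ k := by
      have : q ^ t * M ≤ w * b ^ k :=
        calc q ^ t * M ≤ (q ^ t / (b ^ k / 2)) * b ^ k * M := Nat.mul_le_mul_right _ hfl
          _ = M * (q ^ t / (b ^ k / 2)) * b ^ k := by ring
          _ ≤ _ := Nat.mul_le_mul_right _ hw
      exact_mod_cast this
    have hK : 0 < (24 * (a : ℝ) ^ 2) ^ ω := by positivity
    have htω : 0 < (t : ℝ) ^ ω := by positivity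
    have hMω' : 0 < (M : ℝ) ^ (ω - 1) := by positivity
    rw [inv_mul_le_iff₀ hK, div_le_iff₀ (by positivity)]
    refine le_of_mul_le_mul_right ?_ hM0
    calc (q : ℝ) ^ t * M ≤ w * b ^ k := hfl'
      _ ≤ w * ((24 * (a : ℝ) ^ 2) ^ ω * ((t : ℝ) ^ ω * (M : ℝ) ^ ω)) := by gcongr
      _ = _ := by rw [hMω]; ring
  -- Here the memory is large compared with a^t. The bound `hA` suffices, since b^t =
  -- (a^t)^(ω-1)·a^t and the first factor is at most (24atM)^(ω-1).
  · have hlt : a ^ t < 24 * a * t * M := by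
      have := Nat.find_min hex (m := t) (by omega)
      omega
    have hup : (a : ℝ) ^ t ≤ 24 * a * (t * M) := by
      have : (a : ℝ) ^ t ≤ 24 * a * t * M := by exact_mod_cast hlt.le
      linarith
    have hat : (0 : ℝ) < (a : ℝ) ^ t := by positivity
    have hbt : (b : ℝ) ^ t ≤
        (24 * a) ^ (ω - 1) * ((t : ℝ) ^ (ω - 1) * (M : ℝ) ^ (ω - 1)) * a ^ t := by
      rw [hpow]
      have h1 : ((a : ℝ) ^ t) ^ ω = ((a : ℝ) ^ t) ^ (ω - 1) * a ^ t := by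
        rw [Real.rpow_sub_one hat.ne']; field_simp
      rw [h1, ← Real.mul_rpow ht0.le hM0.le, ← Real.mul_rpow (by positivity) (by positivity)]
      gcongr
    have hA' : (a : ℝ) ^ t * q ^ t ≤ w * ((2 * t) * (a * b ^ t)) := by
      have h1 : (a : ℝ) ^ t * q ^ t ≤ w * ((t + 1) * (a * b ^ t)) := by exact_mod_cast hA
      refine h1.trans ?_
      gcongr
      linarith
    have hc : 2 * (a : ℝ) * (24 * a) ^ (ω - 1) ≤ (24 * (a : ℝ) ^ 2) ^ ω := by
      calc 2 * (a : ℝ) * (24 * a) ^ (ω - 1) ≤ (24 * a) * (24 * a) ^ (ω - 1) := by gcongr; norm_num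
        _ = (24 * a : ℝ) ^ ω := by
          rw [Real.rpow_sub_one (by positivity)]; field_simp
        _ ≤ _ := by
          apply Real.rpow_le_rpow (by positivity) _ (by linarith)
          nlinarith
    have htω : (t : ℝ) ^ ω = t ^ (ω - 1) * t := by
      rw [Real.rpow_sub_one ht0.ne']; field_simp
    have hK : 0 < (24 * (a : ℝ) ^ 2) ^ ω := by positivity
    rw [inv_mul_le_iff₀ hK, div_le_iff₀ (by positivity), htω]
    refine le_of_mul_le_mul_right ?_ hat
    calc (q : ℝ) ^ t * a ^ t = a ^ t * q ^ t := mul_comm _ _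
      _ ≤ w * ((2 * t) * (a * b ^ t)) := hA'
      _ ≤ w * ((2 * t) * (a * ((24 * a) ^ (ω - 1) *
            ((t : ℝ) ^ (ω - 1) * (M : ℝ) ^ (ω - 1)) * a ^ t))) := by gcongr
      _ = (2 * (a : ℝ) * (24 * a) ^ (ω - 1)) *
            (w * ((t : ℝ) ^ (ω - 1) * t * (M : ℝ) ^ (ω - 1)) * a ^ t) := by ring
      _ ≤ (24 * (a : ℝ) ^ 2) ^ ω *
            (w * ((t : ℝ) ^ (ω - 1) * t * (M : ℝ) ^ (ω - 1)) * a ^ t) := by gcongr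
      _ = _ := by ring

/-- The lower bound for the communication cost of every computational graph that contains the
recursive encoding graph. -/
theorem exists_commCost_bound {S : Type*} [Zero S] {I V : Type} [Finite I] {q N X : ℕ}
    {coef : Fin q → I → S} {T : Fin q → SumTree I} {G : ℕ → CDAG V}
    (hT : ∀ j, (T j).Draws (formSupport coef j)) (Φ : ∀ t, EncodingEmbedding T (G t) t)
    (hN : Nat.card I = N) (hNq : N ≤ q) (hcomp : HasEqualComponents coef X)
    (hcoef : NoMultiplyCopied coef) (hX : X < N) :
    ∃ c : ℝ, 0 < c ∧ ∀ t M : ℕ, 1 ≤ t → 1 ≤ M →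
      ENNReal.ofReal (c * ((q : ℝ) ^ t /
        ((t : ℝ) ^ Real.logb ((N : ℝ) / X) ((q : ℝ) / X) *
          (M : ℝ) ^ (Real.logb ((N : ℝ) / X) ((q : ℝ) / X) - 1)))) ≤ (G t).commCost M := by
  have : Nonempty I := (Nat.card_pos_iff.1 (by omega)).1
  obtain ⟨a, b, ⟨E⟩, hIa, hJb⟩ := hcomp.exists_balancedComponents
  rw [hN] at hIa
  rw [Nat.card_fin] at hJb
  have hX0 : 0 < X := Nat.pos_of_ne_zero (by rintro rfl; omega)
  have ha : 2 ≤ a := by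
    by_contra h
    have : a ≤ 1 := by omega
    have : X * a ≤ X * 1 := Nat.mul_le_mul_left _ this
    omega
  -- The rank bound N ≤ q, divided by X.
  have hab : a ≤ b := Nat.le_of_mul_le_mul_left (hIa ▸ hJb ▸ hNq) hX0
  have hbq : b ≤ q := hJb ▸ Nat.le_mul_of_pos_left b hX0
  have hX0' : (X : ℝ) ≠ 0 := by positivity
  have h1 : (N : ℝ) / X = a := by rw [hIa]; push_cast; field_simp
  have h2 : (q : ℝ) / X = b := by
    have : (q : ℝ) = X * b := by exact_mod_cast hJb
    rw [this]; field_simp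
  rw [h1, h2]
  refine ⟨((24 * (a : ℝ) ^ 2) ^ Real.logb a b)⁻¹, ?_, fun t M ht hM => le_iInf₂ fun σ hσ => ?_⟩
  · have : (0 : ℝ) < a := by exact_mod_cast (show 0 < a by omega)
    positivity
  · refine ENNReal.ofReal_le_of_le_toReal ?_
    rw [ENNReal.toReal_natCast]
    refine real_bound ha hab hbq ht hM ?_ ?_
    · simpa using (Φ t).pow_mul_pow_le E hT hcoef (by omega) hab hσ
    · intro k hk0 hk hMk
      simpa using (Φ t).mul_div_le E hT hcoef ha hab hk0 hk hMk hσ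

/-! ### The recursive algorithm -/

namespace Drawing

variable {R : Type*} [CommRing R] {m n p q : ℕ} {alg : BilinearAlgorithm R m n p q}

theorem disjoint_inputs_ops (D : Drawing alg) (t : ℕ) :
    Disjoint (D.cdag t).inputs (D.cdag t).ops := by
  rw [Set.disjoint_left]
  rintro v (⟨z, hz⟩ | ⟨z, hz⟩) h <;> cases h

/-- The encoding graph of the first factor. -/
def embeddingA (D : Drawing alg) (t : ℕ) : EncodingEmbedding D.treeA (D.cdag t) t where
  vert := .encA
  mul y := .dec (.input y)
  vert_injective _ _ h := by injection h
  mul_injective _ _ h := by injection h with h; injection h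
  edge h := .encA h
  edge_mul y := .mulA y
  vert_mem_ops {u v} h hv := by
    cases v with
    | input z => exact h.elim
    | add y r ν z => exact .encA y r ν z hv
  mul_mem_ops h := .dec _ h
  input_notMem_ops z h := by cases h
  disjoint := D.disjoint_inputs_ops t

/-- The encoding graph of the second factor. -/
def embeddingB (D : Drawing alg) (t : ℕ) : EncodingEmbedding D.treeB (D.cdag t) t where
  vert := .encB
  mul y := .dec (.input y)
  vert_injective _ _ h := by injection h
  mul_injective _ _ h := by injection h with h; injection h
  edge h := .encB h
  edge_mul y := .mulB y
  vert_mem_ops {u v} h hv := by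
    cases v with
    | input z => exact h.elim
    | add y r ν z => exact .encB y r ν z hv
  mul_mem_ops h := .dec _ h
  input_notMem_ops z h := by cases h
  disjoint := D.disjoint_inputs_ops t

end Drawing

end RectMM

end

theorem mainTheorem6 {R : Type*} [CommRing R] [Nontrivial R] {m n p q : ℕ}
    (hm : 0 < m) (hn : 0 < n) (hp : 0 < p)
    (alg : RectMM.BilinearAlgorithm R m n p q) (halg : alg.Correct)
    (D : RectMM.Drawing alg) (X : ℕ) :
    (RectMM.HasEqualComponents alg.encA X → RectMM.NoMultiplyCopied alg.encA → X < m * n →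
      ∃ c : ℝ, 0 < c ∧ ∀ t M : ℕ, 1 ≤ t → 1 ≤ M →
        ENNReal.ofReal (c * ((q : ℝ) ^ t /
          ((t : ℝ) ^ Real.logb ((m * n : ℕ) / X : ℝ) ((q : ℝ) / X) *
            (M : ℝ) ^ (Real.logb ((m * n : ℕ) / X : ℝ) ((q : ℝ) / X) - 1))))
          ≤ (D.cdag t).commCost M) ∧
    (RectMM.HasEqualComponents alg.encB X → RectMM.NoMultiplyCopied alg.encB → X < n * p →
      ∃ c : ℝ, 0 < c ∧ ∀ t M : ℕ, 1 ≤ t → 1 ≤ M →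
        ENNReal.ofReal (c * ((q : ℝ) ^ t /
          ((t : ℝ) ^ Real.logb ((n * p : ℕ) / X : ℝ) ((q : ℝ) / X) *
            (M : ℝ) ^ (Real.logb ((n * p : ℕ) / X : ℝ) ((q : ℝ) / X) - 1))))
          ≤ (D.cdag t).commCost M) := by
  refine ⟨fun h hcopy hX => ?_, fun h hcopy hX => ?_⟩
  · exact RectMM.exists_commCost_bound D.drawsA D.embeddingA (by simp)
      (halg.mul_le_of_pos_right hp) h hcopy hX
  · exact RectMM.exists_commCost_bound D.drawsB D.embeddingB (by simp)
      (halg.mul_le_of_pos_left hm) h hcopy hX
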